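/- Let $\vec{Q}=(Q_1,Q_2,Q_3)$ be a flag matroid of rank $(1,2,3)$ on $[4]=\{1,2,3,4\}$, i.e. $Q_k$ is a matroid of rank $k$ on $[4]$ and, for $i\le j$, every flat of $Q_i$ is a flat of $Q_j$. Let $\mathrm{Fl}(4)\subset \mathbb{P}(\wedge^1\mathbb{C}^4)\times\mathbb{P}(\wedge^2\mathbb{C}^4)\times\mathbb{P}(\wedge^3\mathbb{C}^4)$ be the complete flag variety in its Plücker embedding, and let the stratum $\mathrm{Fl}(\vec{Q})$ be its scheme-theoretic intersection with $T(Q_1)\times T(Q_2)\times T(Q_3)$, where $T(Q_k)=\mathbb{G}_m^{Q_k}/\mathbb{G}_m$ is the locus in $\mathbb{P}(\wedge^k\mathbb{C}^4)$ on which exactly the Plücker coordinates indexed by the bases of $Q_k$ are nonzero. Equivalently, $\mathrm{Fl}(\vec{Q})$ is the affine $\mathbb{C}$-scheme whose coordinate ring is the ring of $\mathbb{G}_m^3$-invariants (the part of multidegree $0$) of $S^{-1}(B/J)$, where $B$ is the polynomial ring over $\mathbb{C}$ in the Plücker variables indexed by bases of $Q_1,Q_2,Q_3$, $S$ is the monoid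 generated by these variables, and $J=(I+\langle p_\lambda : \lambda \text{ not a basis}\rangle)\cap B$ with $I$ the multihomogeneous ideal of $\mathrm{Fl}(4)$. Then $\mathrm{Fl}(\vec{Q})$ is smooth over $\mathbb{C}$ and irreducible (in particular nonempty). Moreover, at least one of the following holds: (i) $\mathrm{Fl}(\vec{Q})$ is a product of smaller strata: there is a subset $\emptyset\ne\lambda\subsetneq[4]$ such that $\vec{Q}|\lambda$ and $\vec{Q}/\lambda$ (restriction and contraction of each $Q_k$) are flag matroids on $\lambda$ and $[4]\setminus\lambda$, possibly with repeated ranks or ranks equal to $0$ or to the size of the ground set, $Q_k=Q_k|\lambda\oplus Q_k/\lambda$ for every $k$, and $\mathrm{Fl}(\vec{Q})\cong\mathrm{Fl}(\vec{Q}|\lambda)\times_{\mathbb{C}}\mathrm{Fl}(\vec{Q}/\lambda)$ over $\mathbb{C}$, where these strata are defined in the same way in the flag varieties of $\mathbb{C}^{\lambda}$ and $\mathbb{C}^{[4]\setminus\lambda}$; (ii) $\mathrm{Fl}(\vec{Q})$ is isomorphic over $\mathbb{C}$ to an open subscheme of an algebraic torus $\mathbb{G}_m^d$ for some $d\ge 0$.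 -/

import Mathlib

/-! Flag matroids, the flag variety in its Plücker embedding, and flag matroid strata, over `ℂ`.

Ground sets are subsets `E` of an ordered type `α`, so that restrictions and contractions (whose
ground sets are smaller) are covered by the same definitions. Ranks may repeat, and may be `0`. -/

/-- `Q` is a flag matroid of rank `(r 0, …, r (s - 1))` on the ground set `E`: the `i`-th constituent
is a matroid of rank `r i` on `E`, and for `i ≤ j` the matroid `Q i` is a quotient of `Q j`, that is,
every flat of `Q i` is a flat of `Q j`. -/
structure IsFlagMatroid {α : Type} {s : ℕ} (E : Set α) (r : Fin s → ℕ) (Q : Fin s → Matroid α) :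
    Prop where
  ground_eq : ∀ i, (Q i).E = E
  eRank_eq : ∀ i, (Q i).eRank = (r i : ℕ∞)
  isFlat_of_le : ∀ i j, i ≤ j → ∀ F : Set α, (Q i).IsFlat F → (Q j).IsFlat F

/-- `p` is a vector of (homogeneous) Plücker coordinates of the `k`-dimensional subspace `F` of
`ℂ^ι`: up to a nonzero scalar, `p l` is the maximal minor with columns `l` of a matrix whose rows
form a basis of `F`. -/
def IsPluckerVector {ι : Type} [LinearOrder ι] {k : ℕ} (F : Submodule ℂ (ι → ℂ))
    (p : {l : Finset ι // l.card = k} → ℂ) : Prop :=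
  ∃ (b : Module.Basis (Fin k) ℂ F) (c : ℂ), c ≠ 0 ∧
    ∀ l, p l = c * Matrix.det
      (Matrix.of fun i j : Fin k => (b i : ι → ℂ) (l.1.orderEmbOfFin l.2 j))

/-- Indices of the Plücker coordinates `p_l` on `ℙ(⋀^{r 0} ℂ^E) × ⋯ × ℙ(⋀^{r (s-1)} ℂ^E)`. -/
abbrev PluckerIndex {α : Type} {s : ℕ} (E : Set α) (r : Fin s → ℕ) : Type :=
  (i : Fin s) × {l : Finset E // l.card = r i}

/-- The multi-cone over the flag variety `Fl(r, E)`: all tuples of Plücker vectors of flags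
`F 0 ⊆ F 1 ⊆ ⋯` of subspaces of `ℂ^E` with `dim (F i) = r i`. -/
def flagCone {α : Type} [LinearOrder α] {s : ℕ} (E : Set α) (r : Fin s → ℕ) :
    Set (PluckerIndex E r → ℂ) :=
  {p | ∃ F : Fin s → Submodule ℂ (E → ℂ), Monotone F ∧
    ∀ i, IsPluckerVector (F i) fun l => p ⟨i, l⟩}

/-- The multihomogeneous ideal of the flag variety `Fl(r, E)`. -/
noncomputable def flagIdeal {α : Type} [LinearOrder α] {s : ℕ} (E : Set α) (r : Fin s → ℕ) :
    Ideal (MvPolynomial (PluckerIndex E r) ℂ) :=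
  MvPolynomial.vanishingIdeal ℂ (flagCone E r)

/-- The Plücker index `x = (i, l)` is a basis of `Q`, that is, `l` is a basis of `Q i`. -/
def IsBaseIndex {α : Type} {s : ℕ} {E : Set α} {r : Fin s → ℕ} (Q : Fin s → Matroid α)
    (x : PluckerIndex E r) : Prop :=
  (Q x.1).IsBase (Subtype.val '' (x.2.1 : Set E))

/-- Indices `(i, l)` with `l` a basis of `Q i`. -/
abbrev BaseIndex {α : Type} {s : ℕ} (E : Set α) (r : Fin s → ℕ) (Q : Fin s → Matroid α) : Type :=
  {x : PluckerIndex E r // IsBaseIndex Q x}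

/-- `I_Q = (I_{r,E} + ⟨p_l : l not a basis of Q⟩) ∩ B_Q`, an ideal of
`B_Q = ℂ[p_l : l a basis of Q]`. -/
noncomputable def stratumIdeal {α : Type} [LinearOrder α] {s : ℕ} (E : Set α) (r : Fin s → ℕ)
    (Q : Fin s → Matroid α) : Ideal (MvPolynomial (BaseIndex E r Q) ℂ) :=
  (flagIdeal E r ⊔ Ideal.span (MvPolynomial.X '' {x | ¬ IsBaseIndex Q x})).comap
    (MvPolynomial.rename (R := ℂ) (Subtype.val : BaseIndex E r Q → PluckerIndex E r))

/-- The multiplicative monoid `S_Q ⊆ B_Q` generated by the variables. -/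
noncomputable def variableMonoid {α : Type} {s : ℕ} (E : Set α) (r : Fin s → ℕ) (Q : Fin s → Matroid α) :
    Submonoid (MvPolynomial (BaseIndex E r Q) ℂ) :=
  Submonoid.closure (Set.range MvPolynomial.X)

/-- The multidegree: `p_(i, l)` has degree the `i`-th unit vector. -/
def multidegree {α : Type} {s : ℕ} (E : Set α) (r : Fin s → ℕ) (Q : Fin s → Matroid α) :
    BaseIndex E r Q → (Fin s → ℕ) :=
  fun x => Pi.single x.1.1 1

/-- `R_Q = S_Q⁻¹ (B_Q / I_Q)`. -/
abbrev LaurentRing {α : Type} [LinearOrder α] {s : ℕ} (E : Set α) (r : Fin s → ℕ)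
    (Q : Fin s → Matroid α) : Type :=
  Localization ((variableMonoid E r Q).map (Ideal.Quotient.mk (stratumIdeal E r Q)))

/-- The natural map `B_Q → R_Q`. -/
noncomputable def toLaurentRing {α : Type} [LinearOrder α] {s : ℕ} (E : Set α) (r : Fin s → ℕ)
    (Q : Fin s → Matroid α) : MvPolynomial (BaseIndex E r Q) ℂ →ₐ[ℂ] LaurentRing E r Q :=
  (IsScalarTower.toAlgHom ℂ (MvPolynomial (BaseIndex E r Q) ℂ ⧸ stratumIdeal E r Q)
    (LaurentRing E r Q)).comp (Ideal.Quotient.mkₐ ℂ (stratumIdeal E r Q))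

/-- The coordinate ring of the stratum of `Q`: the subring of `R_Q` of invariants of the torus
`𝔾ₘ^s`, which scales the variables `p_(i, l)` by the `i`-th coordinate. The invariants are the
elements of multidegree `0`, that is, the fractions `a / m` with `m ∈ S_Q` a monomial and `a ∈ B_Q`
multihomogeneous of the same multidegree as `m`. -/
noncomputable def stratumRing {α : Type} [LinearOrder α] {s : ℕ} (E : Set α) (r : Fin s → ℕ)
    (Q : Fin s → Matroid α) : Subalgebra ℂ (LaurentRing E r Q) where
  carrier := {f | ∃ (d : Fin s → ℕ) (a m : MvPolynomial (BaseIndex E r Q) ℂ),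
    a.IsWeightedHomogeneous (multidegree E r Q) d ∧
    m.IsWeightedHomogeneous (multidegree E r Q) d ∧
    m ∈ variableMonoid E r Q ∧ f * toLaurentRing E r Q m = toLaurentRing E r Q a}
  mul_mem' := by
    rintro f g ⟨d, a, m, ha, hm, hmS, hf⟩ ⟨e, b, n, hb, hn, hnS, hg⟩
    refine ⟨d + e, a * b, m * n, ha.mul hb, hm.mul hn, mul_mem hmS hnS, ?_⟩
    rw [map_mul, map_mul, ← hf, ← hg]
    ring
  add_mem' := by
    rintro f g ⟨d, a, m, ha, hm, hmS, hf⟩ ⟨e, b, n, hb, hn, hnS, hg⟩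
    refine ⟨d + e, a * n + m * b, m * n, (ha.mul hn).add (hm.mul hb), hm.mul hn,
      mul_mem hmS hnS, ?_⟩
    rw [map_add, map_mul, map_mul, map_mul, ← hf, ← hg]
    ring
  algebraMap_mem' c := by
    refine ⟨0, MvPolynomial.C c, 1, MvPolynomial.isWeightedHomogeneous_C _ c,
      MvPolynomial.isWeightedHomogeneous_one _ _, one_mem _, ?_⟩
    rw [map_one, mul_one]
    exact ((toLaurentRing E r Q).commutes c).symm

open AlgebraicGeometry CategoryTheory

/-- The flag matroid stratum `Fl(Q)`, an affine scheme. -/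
noncomputable def flagStratum {α : Type} [LinearOrder α] {s : ℕ} (E : Set α) (r : Fin s → ℕ)
    (Q : Fin s → Matroid α) : Scheme.{0} :=
  Spec (CommRingCat.of (stratumRing E r Q))

/-- The structure morphism `Fl(Q) ⟶ Spec ℂ`. -/
noncomputable def flagStratumToSpec {α : Type} [LinearOrder α] {s : ℕ} (E : Set α)
    (r : Fin s → ℕ) (Q : Fin s → Matroid α) :
    flagStratum E r Q ⟶ Spec (CommRingCat.of ℂ) :=
  Spec.map (CommRingCat.ofHom (algebraMap ℂ (stratumRing E r Q)))

/-- The torus `𝔾ₘ^d` over `ℂ`: the spectrum of the ring of Laurent polynomials in `d` variables. -/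
noncomputable def algTorus (d : ℕ) : Scheme.{0} :=
  Spec (CommRingCat.of (AddMonoidAlgebra ℂ (Fin d → ℤ)))

/-- The structure morphism `𝔾ₘ^d ⟶ Spec ℂ`. -/
noncomputable def algTorusToSpec (d : ℕ) : algTorus d ⟶ Spec (CommRingCat.of ℂ) :=
  Spec.map (CommRingCat.ofHom (algebraMap ℂ (AddMonoidAlgebra ℂ (Fin d → ℤ))))

/-- `Fl(Q)` is a product of smaller strata: for a nonempty proper subset `L` of the ground set `E`,
`Q` is the direct sum of the restriction `Q | L` and the contraction `Q / L`, these are flag matroids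
on `L` and on `E \ L`, and `Fl(Q) ≅ Fl(Q | L) × Fl(Q / L)` over `ℂ`. -/
def IsProductOfSmallerStrata {α : Type} [LinearOrder α] {s : ℕ} (E : Set α) (r : Fin s → ℕ)
    (Q : Fin s → Matroid α) : Prop :=
  ∃ (L : Set α) (r₁ r₂ : Fin s → ℕ), L.Nonempty ∧ L ⊂ E ∧
    IsFlagMatroid L r₁ (fun i => (Q i).restrict L) ∧
    IsFlagMatroid (E \ L) r₂ (fun i => (Q i).contract L) ∧
    (∀ i, ∃ h, Q i = ((Q i).restrict L).disjointSum ((Q i).contract L) h) ∧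
    ∃ e : flagStratum E r Q ≅
        Limits.pullback (flagStratumToSpec L r₁ fun i => (Q i).restrict L)
          (flagStratumToSpec (E \ L) r₂ fun i => (Q i).contract L),
      e.hom ≫ Limits.pullback.fst _ _ ≫ flagStratumToSpec L r₁ (fun i => (Q i).restrict L) =
        flagStratumToSpec E r Q

/-- `Fl(Q)` is isomorphic, over `ℂ`, to an open subvariety of a torus. -/
def IsOpenInTorus {α : Type} [LinearOrder α] {s : ℕ} (E : Set α) (r : Fin s → ℕ)
    (Q : Fin s → Matroid α) : Prop :=
  ∃ (d : ℕ) (f : flagStratum E r Q ⟶ algTorus d),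
    IsOpenImmersion f ∧ f ≫ algTorusToSpec d = flagStratumToSpec E r Q

/-!
A flag is a point on a line in a plane of `ℙ³`. Present the line as the row space of a `2 × 4`
matrix, and normalize two columns `i` and `r` which form a basis of `Q 1` to the unit vectors. The
other nonzero columns are then given by one scale each and one slope for each parallel class which
does not contain `i` or `r`. The point lies on the line, so its position there is one more
parameter. As `Q 0` is a quotient of `Q 1`, its nonloops are either all nonloops of `Q 1` or those
outside one parallel class; choosing `r` in that class makes the parameter of the point generic in
the first case and zero in the second. The Hodge star turns the plane into a point on the dual line,
which is treated in the same way.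

Thus the Plücker coordinates are polynomials in the free parameters, and conversely each free
parameter is, up to sign, a ratio of two Plücker coordinates indexed by bases. Hence the coordinate
ring of the stratum is the localization of a polynomial ring at the product of the nonvanishing
coordinates, and every variable divides this product, so that the stratum is open in a torus.
-/

section Laurent

variable {R S τ : Type*} [CommRing R] [CommRing S] [Algebra R S]

/-- The inclusion of polynomials in the variables `τ` into Laurent polynomials, which are encoded as
the monoid algebra of `τ → ℤ`. -/
noncomputable def toLaurent (R τ : Type*) [CommRing R] :
    MvPolynomial τ R →ₐ[R] AddMonoidAlgebra R (τ → ℤ) :=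
  AddMonoidAlgebra.mapDomainAlgHom R R
    ((Nat.castAddMonoidHom ℤ).compLeft τ |>.comp Finsupp.coeFnAddHom)

theorem toLaurent_monomial (k : τ →₀ ℕ) (c : R) :
    toLaurent R τ (MvPolynomial.monomial k c) = AddMonoidAlgebra.single (fun s => (k s : ℤ)) c :=
  AddMonoidAlgebra.mapDomain_single

theorem exists_mul_toLaurent_monomial_eq [Finite τ] (z : AddMonoidAlgebra R (τ → ℤ)) :
    ∃ (k : τ →₀ ℕ) (g : MvPolynomial τ R),
      z * toLaurent R τ (MvPolynomial.monomial k 1) = toLaurent R τ g := by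
  induction z using AddMonoidAlgebra.induction_on with
  | of m =>
    refine ⟨Finsupp.equivFunOnFinite.symm fun s => (-m s).toNat,
      MvPolynomial.monomial (Finsupp.equivFunOnFinite.symm fun s => (m s).toNat) 1, ?_⟩
    rw [toLaurent_monomial, toLaurent_monomial, AddMonoidAlgebra.of_apply,
      AddMonoidAlgebra.single_mul_single, one_mul]
    congr 1
    ext s
    simp only [toAdd_ofAdd, Pi.add_apply, Finsupp.coe_equivFunOnFinite_symm, Int.ofNat_toNat]
    omega
  | add x y hx hy =>
    obtain ⟨k, g, hg⟩ := hx
    obtain ⟨l, h, hh⟩ := hy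
    refine ⟨k + l, g * MvPolynomial.monomial l 1 + h * MvPolynomial.monomial k 1, ?_⟩
    have hmul : MvPolynomial.monomial (k + l) (1 : R) =
        MvPolynomial.monomial k 1 * MvPolynomial.monomial l 1 := by
      rw [MvPolynomial.monomial_mul, one_mul]
    rw [hmul, map_mul, map_add, map_mul, map_mul, ← hg, ← hh]
    ring
  | smul c x hx =>
    obtain ⟨k, g, hg⟩ := hx
    exact ⟨k, c • g, by rw [smul_mul_assoc, hg, map_smul]⟩

theorem isUnit_toLaurent_monomial (k : τ →₀ ℕ) :
    IsUnit (toLaurent R τ (MvPolynomial.monomial k 1)) := by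
  rw [toLaurent_monomial]
  refine IsUnit.of_mul_eq_one (AddMonoidAlgebra.single (-fun s => (k s : ℤ)) 1) ?_
  rw [AddMonoidAlgebra.single_mul_single, add_neg_cancel, one_mul, AddMonoidAlgebra.one_def]

/-- The homomorphism from Laurent polynomials which sends the variables to the units `v`. -/
noncomputable def laurentLift [Fintype τ] (v : τ → Sˣ) : AddMonoidAlgebra R (τ → ℤ) →ₐ[R] S :=
  AddMonoidAlgebra.lift R S (τ → ℤ)
    { toFun := fun z => ((∏ s, v s ^ (z.toAdd s) : Sˣ) : S)
      map_one' := by simp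
      map_mul' := fun x y => by simp [zpow_add, Finset.prod_mul_distrib] }

theorem laurentLift_toLaurent [Fintype τ] (v : τ → Sˣ) (g : MvPolynomial τ R) :
    laurentLift v (toLaurent R τ g) = MvPolynomial.aeval (fun s => (v s : S)) g := by
  classical
  suffices h : (laurentLift v).comp (toLaurent R τ) = MvPolynomial.aeval fun s => (v s : S) from
    DFunLike.congr_fun h g
  refine MvPolynomial.algHom_ext fun s => ?_
  rw [AlgHom.comp_apply, MvPolynomial.X, toLaurent_monomial, laurentLift,
    AddMonoidAlgebra.lift_single, one_smul, ← MvPolynomial.X, MvPolynomial.aeval_X]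
  refine congrArg Units.val ((Finset.prod_eq_single s ?_ (by simp)).trans (by simp))
  intro t _ hts
  simp [Finsupp.single_eq_of_ne hts]

end Laurent

section LocalizationOfPolynomials

variable {R S τ : Type*} [CommRing R] [CommRing S] [Algebra R S]
  [Algebra (MvPolynomial τ R) S] [IsScalarTower R (MvPolynomial τ R) S]
  (f : MvPolynomial τ R) [IsLocalization.Away f S]

include f in
theorem smooth_of_isLocalizationAway_mvPolynomial [Finite τ] : Algebra.Smooth R S := by
  have : Algebra.Smooth (MvPolynomial τ R) S := Algebra.Smooth.of_isLocalization_Away f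
  have : Algebra.Smooth R (MvPolynomial τ R) := ⟨inferInstance, inferInstance⟩
  exact Algebra.Smooth.comp R (MvPolynomial τ R) S

theorem isLocalizationAway_toLaurent [Fintype τ] {v : τ → Sˣ}
    (hv : ∀ s, v s = algebraMap (MvPolynomial τ R) S (MvPolynomial.X s)) :
    let := (laurentLift (R := R) v).toAlgebra
    IsLocalization.Away (toLaurent R τ f) S := by
  let := (laurentLift (R := R) v).toAlgebra
  have algebraMap_toLaurent (g) :
      algebraMap (AddMonoidAlgebra R (τ → ℤ)) S (toLaurent R τ g) = algebraMap _ S g := by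
    refine (laurentLift_toLaurent v g).trans ?_
    simp only [hv]
    exact (DFunLike.congr_fun (MvPolynomial.aeval_unique
      (IsScalarTower.toAlgHom R (MvPolynomial τ R) S)) g).symm
  refine IsLocalization.Away.mk _ ?_ (fun x => ?_) fun z w hzw => ?_
  · rw [algebraMap_toLaurent]
    exact IsLocalization.Away.algebraMap_isUnit f
  · obtain ⟨n, g, hg⟩ := IsLocalization.Away.surj f x
    exact ⟨n, toLaurent R τ g, by rwa [algebraMap_toLaurent, algebraMap_toLaurent]⟩
  · obtain ⟨k, g, hg⟩ := exists_mul_toLaurent_monomial_eq (z - w)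
    have algebraMap_g : algebraMap _ S g = 0 := by
      rw [← algebraMap_toLaurent, ← hg, map_mul, map_sub, hzw, sub_self, zero_mul]
    obtain ⟨n, hn⟩ := IsLocalization.Away.exists_of_eq (S := S) f
      (algebraMap_g.trans (map_zero _).symm)
    refine ⟨n, sub_eq_zero.mp ?_⟩
    rw [← mul_sub, ← (isUnit_toLaurent_monomial k).mul_left_eq_zero, mul_assoc, hg, ← map_pow,
      ← map_mul, hn, mul_zero, map_zero]

end LocalizationOfPolynomials

theorem exists_isOpenImmersion_algTorus {S τ : Type} [CommRing S] [Algebra ℂ S] [Finite τ]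
    [Algebra (MvPolynomial τ ℂ) S] [IsScalarTower ℂ (MvPolynomial τ ℂ) S]
    {f : MvPolynomial τ ℂ} [IsLocalization.Away f S] (hX : ∀ s, MvPolynomial.X s ∣ f) :
    ∃ (d : ℕ) (F : Spec (CommRingCat.of S) ⟶ algTorus d), IsOpenImmersion F ∧
      F ≫ algTorusToSpec d = Spec.map (CommRingCat.ofHom (algebraMap ℂ S)) := by
  obtain ⟨d, ⟨e⟩⟩ := Finite.exists_equiv_fin τ
  have := Fintype.ofFinite τ
  let v (s : τ) : Sˣ := (IsLocalization.Away.isUnit_of_dvd (S := S) f (hX s)).unit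
  let φ : AddMonoidAlgebra ℂ (τ → ℤ) →ₐ[ℂ] S := laurentLift v
  let ψ : AddMonoidAlgebra ℂ (Fin d → ℤ) ≃ₐ[ℂ] AddMonoidAlgebra ℂ (τ → ℤ) :=
    AddMonoidAlgebra.domCongr ℂ ℂ (LinearEquiv.funCongrLeft ℤ ℤ e).toAddEquiv
  have isOpenImmersion_φ : IsOpenImmersion (Spec.map (CommRingCat.ofHom φ.toRingHom)) := by
    let := φ.toAlgebra
    have := isLocalizationAway_toLaurent (S := S) f (v := v) fun _ => rfl
    exact IsOpenImmersion.of_isLocalization (toLaurent ℂ τ f)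
  have isOpenImmersion_comp : IsOpenImmersion
      (Spec.map (ψ.toRingEquiv.toCommRingCatIso.hom ≫ CommRingCat.ofHom φ.toRingHom)) := by
    rw [Spec.map_comp]
    infer_instance
  refine ⟨d, _, isOpenImmersion_comp, ?_⟩
  refine (Spec.map_comp _ _).symm.trans (congrArg Spec.map (CommRingCat.hom_ext ?_))
  exact (φ.comp ψ.toAlgHom).comp_algebraMap
section Coordinates

variable {α : Type} {s : ℕ} {E : Set α} {r : Fin s → ℕ} {Q : Fin s → Matroid α}

theorem X_mem_variableMonoid (x : BaseIndex E r Q) : MvPolynomial.X x ∈ variableMonoid E r Q :=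
  Submonoid.subset_closure ⟨x, rfl⟩

variable [LinearOrder α]

open Classical in
/-- The Plücker coordinates as elements of `R_Q`, extended by `0` to all indices. -/
noncomputable def laurentCoord (Q : Fin s → Matroid α) (x : PluckerIndex E r) : LaurentRing E r Q :=
  if h : IsBaseIndex Q x then toLaurentRing E r Q (MvPolynomial.X ⟨x, h⟩) else 0

theorem laurentCoord_of_isBaseIndex {x : PluckerIndex E r} (h : IsBaseIndex Q x) :
    laurentCoord Q x = toLaurentRing E r Q (MvPolynomial.X ⟨x, h⟩) := dif_pos h

theorem laurentCoord_of_not_isBaseIndex {x : PluckerIndex E r} (h : ¬ IsBaseIndex Q x) :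
    laurentCoord Q x = 0 := dif_neg h

theorem isUnit_laurentCoord {x : PluckerIndex E r} (h : IsBaseIndex Q x) :
    IsUnit (laurentCoord Q x) := by
  rw [laurentCoord_of_isBaseIndex h]
  exact IsLocalization.map_units (LaurentRing E r Q)
    (⟨_, Submonoid.mem_map_of_mem _ (X_mem_variableMonoid _)⟩ :
      (variableMonoid E r Q).map (Ideal.Quotient.mk (stratumIdeal E r Q)))

theorem toLaurentRing_eq_aeval_laurentCoord (g : MvPolynomial (BaseIndex E r Q) ℂ) :
    toLaurentRing E r Q g =
      MvPolynomial.aeval (fun x : BaseIndex E r Q => laurentCoord Q x.1) g := by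
  refine (DFunLike.congr_fun (MvPolynomial.aeval_unique (toLaurentRing E r Q)) g).trans ?_
  congr 2
  ext x
  exact (laurentCoord_of_isBaseIndex x.2).symm

theorem toLaurentRing_eq_zero {g : MvPolynomial (BaseIndex E r Q) ℂ} (hg : g ∈ stratumIdeal E r Q) :
    toLaurentRing E r Q g = 0 :=
  (congrArg (algebraMap _ (LaurentRing E r Q)) (Ideal.Quotient.eq_zero_iff_mem.mpr hg)).trans
    (map_zero _)

theorem aeval_laurentCoord_eq_zero {g : MvPolynomial (PluckerIndex E r) ℂ}
    (hg : g ∈ flagIdeal E r) : MvPolynomial.aeval (laurentCoord Q) g = 0 := by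
  classical
  let ρ : MvPolynomial (PluckerIndex E r) ℂ →ₐ[ℂ] MvPolynomial (BaseIndex E r Q) ℂ :=
    MvPolynomial.aeval fun x => if h : IsBaseIndex Q x then MvPolynomial.X ⟨x, h⟩ else 0
  let J : Ideal (MvPolynomial (PluckerIndex E r) ℂ) :=
    Ideal.span (MvPolynomial.X '' {x | ¬ IsBaseIndex Q x})
  have aeval_eq : MvPolynomial.aeval (laurentCoord Q) = (toLaurentRing E r Q).comp ρ := by
    refine MvPolynomial.algHom_ext fun x => ?_
    by_cases h : IsBaseIndex Q x
    · simp [ρ, h, laurentCoord_of_isBaseIndex h]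
    · simp [ρ, h, laurentCoord_of_not_isBaseIndex h]
  have mk_comp_rename_comp_ρ : (Ideal.Quotient.mkₐ ℂ J).comp
      ((MvPolynomial.rename Subtype.val).comp ρ) = Ideal.Quotient.mkₐ ℂ J := by
    refine MvPolynomial.algHom_ext fun x => ?_
    by_cases h : IsBaseIndex Q x
    · simp [ρ, h]
    · have : Ideal.Quotient.mk J (MvPolynomial.X x) = 0 :=
        Ideal.Quotient.eq_zero_iff_mem.mpr (Ideal.subset_span ⟨x, h, rfl⟩)
      simp [ρ, h, this]
  have rename_ρ_sub_mem : MvPolynomial.rename Subtype.val (ρ g) - g ∈ J :=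
    Ideal.Quotient.eq.mp (DFunLike.congr_fun mk_comp_rename_comp_ρ g)
  rw [aeval_eq, AlgHom.comp_apply]
  refine toLaurentRing_eq_zero (Ideal.mem_comap.mpr ?_)
  simpa using Ideal.add_mem _ (Ideal.mem_sup_right (S := flagIdeal E r) rename_ρ_sub_mem)
    (Ideal.mem_sup_left hg)

theorem exists_algHom_laurentRing {A : Type*} [CommRing A] [Algebra ℂ A] {p : PluckerIndex E r → A}
    (aeval_eq_zero : ∀ g ∈ flagIdeal E r, MvPolynomial.aeval p g = 0)
    (isUnit : ∀ x, IsBaseIndex Q x → IsUnit (p x)) (eq_zero : ∀ x, ¬ IsBaseIndex Q x → p x = 0) :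
    ∃ φ : LaurentRing E r Q →ₐ[ℂ] A, ∀ x, φ (laurentCoord Q x) = p x := by
  let φ : MvPolynomial (BaseIndex E r Q) ℂ →ₐ[ℂ] A := MvPolynomial.aeval fun x => p x.1
  have stratumIdeal_le_ker : ∀ g ∈ stratumIdeal E r Q, φ g = 0 := by
    intro g hg
    have sup_le_ker : flagIdeal E r ⊔ Ideal.span (MvPolynomial.X '' {x | ¬ IsBaseIndex Q x}) ≤
        RingHom.ker (MvPolynomial.aeval (R := ℂ) p) := by
      refine sup_le aeval_eq_zero (Ideal.span_le.mpr ?_)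
      rintro _ ⟨x, hx, rfl⟩
      simpa [RingHom.mem_ker] using eq_zero x hx
    exact (MvPolynomial.aeval_rename _ _ _).symm.trans (sup_le_ker hg)
  let ψ : (MvPolynomial (BaseIndex E r Q) ℂ ⧸ stratumIdeal E r Q) →ₐ[ℂ] A :=
    Ideal.Quotient.liftₐ _ φ stratumIdeal_le_ker
  have isUnit_ψ (y : (variableMonoid E r Q).map (Ideal.Quotient.mk (stratumIdeal E r Q))) :
      IsUnit (ψ y) := by
    obtain ⟨_, m, hm, rfl⟩ := y
    suffices h : variableMonoid E r Q ≤ (IsUnit.submonoid A).comap φ from h hm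
    refine Submonoid.closure_le.mpr ?_
    rintro _ ⟨x, rfl⟩
    simpa [φ, IsUnit.mem_submonoid_iff] using isUnit x.1 x.2
  refine ⟨IsLocalization.liftAlgHom (f := ψ) isUnit_ψ, fun x => ?_⟩
  by_cases h : IsBaseIndex Q x
  · rw [laurentCoord_of_isBaseIndex h]
    exact (IsLocalization.lift_eq _ _).trans (MvPolynomial.aeval_X _ _)
  · rw [laurentCoord_of_not_isBaseIndex h, map_zero, eq_zero x h]

/-- The ratio `p_(i, l) / p_(i, m)` of two Plücker coordinates as a function on the stratum of `Q`.
It is `0` if `m` is not a basis of `Q i`. -/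
noncomputable def coordRatio (Q : Fin s → Matroid α) (i : Fin s)
    (l m : {l : Finset E // l.card = r i}) : stratumRing E r Q :=
  ⟨laurentCoord Q ⟨i, l⟩ * Ring.inverse (laurentCoord Q ⟨i, m⟩), by
    by_cases hm : IsBaseIndex Q ⟨i, m⟩
    · by_cases hl : IsBaseIndex Q ⟨i, l⟩
      · refine ⟨Pi.single i 1, MvPolynomial.X ⟨_, hl⟩, MvPolynomial.X ⟨_, hm⟩,
          MvPolynomial.isWeightedHomogeneous_X _ _ _, MvPolynomial.isWeightedHomogeneous_X _ _ _,
          X_mem_variableMonoid _, ?_⟩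
        rw [← laurentCoord_of_isBaseIndex hl, ← laurentCoord_of_isBaseIndex hm,
          Ring.inverse_mul_cancel_right _ _ (isUnit_laurentCoord hm)]
      · rw [laurentCoord_of_not_isBaseIndex hl, zero_mul]
        exact zero_mem _
    · rw [laurentCoord_of_not_isBaseIndex hm, Ring.inverse_zero, mul_zero]
      exact zero_mem _⟩

variable {i : Fin s} {l m : {l : Finset E // l.card = r i}}

theorem coe_coordRatio (l m : {l : Finset E // l.card = r i}) :
    (coordRatio Q i l m : LaurentRing E r Q) =
      laurentCoord Q ⟨i, l⟩ * Ring.inverse (laurentCoord Q ⟨i, m⟩) := rfl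

theorem laurentCoord_mul_coordRatio (hm : IsBaseIndex Q ⟨i, m⟩) :
    laurentCoord Q ⟨i, m⟩ * (coordRatio Q i l m : LaurentRing E r Q) = laurentCoord Q ⟨i, l⟩ := by
  rw [coe_coordRatio, mul_left_comm, Ring.mul_inverse_cancel _ (isUnit_laurentCoord hm), mul_one]

theorem coordRatio_self (hm : IsBaseIndex Q ⟨i, m⟩) : coordRatio Q i m m = 1 :=
  Subtype.ext (Ring.mul_inverse_cancel _ (isUnit_laurentCoord hm))

theorem coordRatio_mul_coordRatio (hm : IsBaseIndex Q ⟨i, m⟩)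
    (l n : {l : Finset E // l.card = r i}) :
    coordRatio Q i l m * coordRatio Q i m n = coordRatio Q i l n := by
  refine Subtype.ext ?_
  rw [MulMemClass.coe_mul, coe_coordRatio l, coe_coordRatio m, ← mul_assoc,
    Ring.inverse_mul_cancel_right _ _ (isUnit_laurentCoord hm), coe_coordRatio]

theorem isUnit_coordRatio (hl : IsBaseIndex Q ⟨i, l⟩) (hm : IsBaseIndex Q ⟨i, m⟩) :
    IsUnit (coordRatio Q i l m) :=
  IsUnit.of_mul_eq_one _ ((coordRatio_mul_coordRatio hm l l).trans (coordRatio_self hl))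

theorem coordRatio_of_not_isBaseIndex (hl : ¬ IsBaseIndex Q ⟨i, l⟩) : coordRatio Q i l m = 0 :=
  Subtype.ext (by rw [coe_coordRatio, laurentCoord_of_not_isBaseIndex hl, zero_mul]; rfl)

end Coordinates

theorem aeval_mul_of_isWeightedHomogeneous {R A σ ι : Type*} [CommSemiring R] [CommSemiring A]
    [Algebra R A] [Fintype ι] [DecidableEq ι] {deg : σ → ι} {a : MvPolynomial σ R} {d : ι → ℕ}
    (ha : a.IsWeightedHomogeneous (fun x => (Pi.single (deg x) 1 : ι → ℕ)) d)
    (t : ι → A) (c : σ → A) :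
    MvPolynomial.aeval (fun x => t (deg x) * c x) a =
      (∏ i, t i ^ d i) * MvPolynomial.aeval c a := by
  have prod_eq (μ : σ →₀ ℕ) : (μ.prod fun x k => t (deg x) ^ k) =
      ∏ i, t i ^ Finsupp.weight (fun x => (Pi.single (deg x) 1 : ι → ℕ)) μ i := by
    induction μ using Finsupp.induction_linear with
    | zero => simp
    | add f g hf hg =>
      rw [Finsupp.prod_add_index' (by simp) (by simp [pow_add]), hf, hg, map_add]
      simp only [Pi.add_apply, pow_add, Finset.prod_mul_distrib]
    | single x k =>
      rw [Finsupp.prod_single_index (by simp), Finsupp.weight_single,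
        Finset.prod_eq_single (deg x) (fun i _ hi => by simp [hi]) (by simp)]
      simp
  induction ha using MvPolynomial.IsWeightedHomogeneous.induction_on with
  | zero => simp
  | add p q hp hq ihp ihq => rw [map_add, map_add, ihp, ihq, mul_add]
  | monomial μ z hμ =>
    simp only [MvPolynomial.aeval_monomial, mul_pow, Finsupp.prod_mul, prod_eq, hμ]
    ring

section StratumChart

variable {α : Type} [LinearOrder α] {s : ℕ} {E : Set α} {r : Fin s → ℕ} {Q : Fin s → Matroid α}

theorem toLaurentRing_eq_prod_mul_aeval_coordRatio {index : ∀ i, {l : Finset E // l.card = r i}}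
    (hindex : ∀ i, IsBaseIndex Q ⟨i, index i⟩) {a : MvPolynomial (BaseIndex E r Q) ℂ}
    {d : Fin s → ℕ} (ha : a.IsWeightedHomogeneous (multidegree E r Q) d) :
    toLaurentRing E r Q a = (∏ i, laurentCoord Q ⟨i, index i⟩ ^ d i) *
      (MvPolynomial.aeval
        (fun x : BaseIndex E r Q => coordRatio Q x.1.1 x.1.2 (index x.1.1)) a :) := by
  rw [← Subalgebra.coe_val, MvPolynomial.comp_aeval_apply]
  refine (toLaurentRing_eq_aeval_laurentCoord a).trans (Eq.trans ?_
    (aeval_mul_of_isWeightedHomogeneous (deg := fun x : BaseIndex E r Q => x.1.1) ha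
      (fun i => laurentCoord Q ⟨i, index i⟩) _))
  congr 2
  ext x
  exact (laurentCoord_mul_coordRatio (hindex x.1.1)).symm

theorem exists_mul_aeval_coordRatio_eq {index : ∀ i, {l : Finset E // l.card = r i}}
    (hindex : ∀ i, IsBaseIndex Q ⟨i, index i⟩) (f : stratumRing E r Q) :
    ∃ a : MvPolynomial (BaseIndex E r Q) ℂ, ∃ m ∈ variableMonoid E r Q,
      f * MvPolynomial.aeval
          (fun x : BaseIndex E r Q => coordRatio Q x.1.1 x.1.2 (index x.1.1)) m =
        MvPolynomial.aeval
          (fun x : BaseIndex E r Q => coordRatio Q x.1.1 x.1.2 (index x.1.1)) a := by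
  obtain ⟨d, a, m, ha, hm, hmS, hf⟩ := f.2
  have isUnit_prod : IsUnit (∏ i, laurentCoord Q ⟨i, index i⟩ ^ d i) :=
    IsUnit.prod_univ_iff.mpr fun i => (isUnit_laurentCoord (hindex i)).pow _
  refine ⟨a, m, hmS, Subtype.ext (isUnit_prod.mul_left_cancel ?_)⟩
  rw [← toLaurentRing_eq_prod_mul_aeval_coordRatio hindex ha, ← hf,
    toLaurentRing_eq_prod_mul_aeval_coordRatio hindex hm, MulMemClass.coe_mul, mul_left_comm]

theorem eq_top_of_coordRatio_mem {index : ∀ i, {l : Finset E // l.card = r i}}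
    (hindex : ∀ i, IsBaseIndex Q ⟨i, index i⟩) {T : Subalgebra ℂ (stratumRing E r Q)}
    (hT : ∀ i l m, IsBaseIndex Q ⟨i, l⟩ → IsBaseIndex Q ⟨i, m⟩ → coordRatio Q i l m ∈ T) :
    T = ⊤ := by
  let ratio (x : BaseIndex E r Q) : stratumRing E r Q := coordRatio Q x.1.1 x.1.2 (index x.1.1)
  have aeval_ratio_mem (a : MvPolynomial (BaseIndex E r Q) ℂ) :
      MvPolynomial.aeval ratio a ∈ T := by
    induction a using MvPolynomial.induction_on with
    | C z => simp
    | add p q hp hq => simpa using add_mem hp hq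
    | mul_X p x hp => simpa using mul_mem hp (hT _ _ _ x.2 (hindex x.1.1))
  have exists_inverse {m : MvPolynomial (BaseIndex E r Q) ℂ} (hm : m ∈ variableMonoid E r Q) :
      ∃ y ∈ T, MvPolynomial.aeval ratio m * y = 1 := by
    induction hm using Submonoid.closure_induction with
    | mem m hm =>
      obtain ⟨x, rfl⟩ := hm
      refine ⟨_, hT x.1.1 _ _ (hindex _) x.2, ?_⟩
      rw [MvPolynomial.aeval_X]
      exact (coordRatio_mul_coordRatio (hindex _) _ _).trans (coordRatio_self x.2)
    | one => exact ⟨1, one_mem T, by simp⟩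
    | mul m n _ _ ihm ihn =>
      obtain ⟨y, hy, hmy⟩ := ihm
      obtain ⟨z, hz, hnz⟩ := ihn
      refine ⟨y * z, mul_mem hy hz, ?_⟩
      rw [map_mul, mul_mul_mul_comm, hmy, hnz, one_mul]
  rw [eq_top_iff]
  rintro f -
  obtain ⟨a, m, hm, mul_eq⟩ := exists_mul_aeval_coordRatio_eq hindex f
  obtain ⟨y, hy, hmy⟩ := exists_inverse hm
  have f_eq : f = MvPolynomial.aeval ratio a * y := by
    rw [← mul_eq, mul_assoc, hmy, mul_one]
  rw [f_eq]
  exact mul_mem (aeval_ratio_mem a) hy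

/-- A rational parametrization of the stratum of `Q` with parameters `τ`: polynomials `coord x` in
the parameters which express the Plücker coordinates up to a common unit for every constituent of
the flag, the parameters being scalar multiples of ratios of Plücker coordinates. -/
structure StratumChart (E : Set α) (r : Fin s → ℕ) (Q : Fin s → Matroid α) (τ : Type) where
  coord : PluckerIndex E r → MvPolynomial τ ℂ
  coord_ne_zero_iff : ∀ x, coord x ≠ 0 ↔ IsBaseIndex Q x
  aeval_coord_mem_flagCone : ∀ t : τ → ℂ,
    (∀ x, IsBaseIndex Q x → MvPolynomial.aeval t (coord x) ≠ 0) →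
      (fun x => MvPolynomial.aeval t (coord x)) ∈ flagCone E r
  index : ∀ i, {l : Finset E // l.card = r i}
  isBaseIndex_index : ∀ i, IsBaseIndex Q ⟨i, index i⟩
  param : τ → stratumRing E r Q
  exists_X_eq_param_eq : ∀ v, ∃ i l m, ∃ z : ℂ, IsBaseIndex Q ⟨i, l⟩ ∧ IsBaseIndex Q ⟨i, m⟩ ∧
    MvPolynomial.X v * coord ⟨i, m⟩ = MvPolynomial.C z * coord ⟨i, l⟩ ∧
    param v * coordRatio Q i m (index i) = z • coordRatio Q i l (index i)
  exists_isUnit_aeval_coord : ∀ i, ∃ d : stratumRing E r Q, IsUnit d ∧ ∀ l,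
    MvPolynomial.aeval param (coord ⟨i, l⟩) = d * coordRatio Q i l (index i)

namespace StratumChart

variable {τ : Type} (c : StratumChart E r Q τ)

/-- The homomorphism of coordinate rings of the map from the stratum to affine space given by the
parameters of a chart. -/
noncomputable def paramHom : MvPolynomial τ ℂ →ₐ[ℂ] stratumRing E r Q :=
  MvPolynomial.aeval c.param

theorem isUnit_paramHom_coord {x : PluckerIndex E r} (hx : IsBaseIndex Q x) :
    IsUnit (c.paramHom (c.coord x)) := by
  obtain ⟨i, l⟩ := x
  obtain ⟨d, hd, paramHom_coord⟩ := c.exists_isUnit_aeval_coord i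
  rw [paramHom, paramHom_coord]
  exact hd.mul (isUnit_coordRatio hx (c.isBaseIndex_index i))

theorem coordRatio_mul_paramHom_coord {i : Fin s} {m : {l : Finset E // l.card = r i}}
    (hm : IsBaseIndex Q ⟨i, m⟩) (l : {l : Finset E // l.card = r i}) :
    coordRatio Q i l m * c.paramHom (c.coord ⟨i, m⟩) = c.paramHom (c.coord ⟨i, l⟩) := by
  obtain ⟨d, -, paramHom_coord⟩ := c.exists_isUnit_aeval_coord i
  rw [paramHom, paramHom_coord, paramHom_coord, mul_left_comm, coordRatio_mul_coordRatio hm]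

variable [Finite E]

/-- The product of the coordinates of a chart which do not vanish on the stratum. -/
noncomputable def coordProd : MvPolynomial τ ℂ :=
  ∏ᶠ x : BaseIndex E r Q, c.coord x.1

theorem coord_dvd_coordProd {x : PluckerIndex E r} (hx : IsBaseIndex Q x) :
    c.coord x ∣ c.coordProd := by
  let y : BaseIndex E r Q := ⟨x, hx⟩
  exact finprod_mem_dvd (f := fun x : BaseIndex E r Q => c.coord x.1) y (Set.toFinite _)

theorem coordProd_ne_zero : c.coordProd ≠ 0 := by
  have := Fintype.ofFinite (BaseIndex E r Q)
  rw [coordProd, finprod_eq_prod_of_fintype]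
  exact Finset.prod_ne_zero_iff.mpr fun x _ => (c.coord_ne_zero_iff x.1).mpr x.2

theorem isUnit_paramHom_coordProd : IsUnit (c.paramHom c.coordProd) := by
  have := Fintype.ofFinite (BaseIndex E r Q)
  rw [coordProd, finprod_eq_prod_of_fintype, map_prod]
  exact IsUnit.prod_univ_iff.mpr fun x => c.isUnit_paramHom_coord x.2

theorem X_dvd_coordProd (v : τ) : MvPolynomial.X v ∣ c.coordProd := by
  obtain ⟨i, l, m, z, hl, hm, X_mul, -⟩ := c.exists_X_eq_param_eq v
  have z_ne_zero : z ≠ 0 := by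
    rintro rfl
    rw [map_zero, zero_mul] at X_mul
    exact mul_ne_zero (MvPolynomial.X_ne_zero v) ((c.coord_ne_zero_iff _).mpr hm) X_mul
  have coord_eq : c.coord ⟨i, l⟩ =
      MvPolynomial.X v * (c.coord ⟨i, m⟩ * MvPolynomial.C z⁻¹) := by
    rw [← mul_assoc, X_mul, mul_right_comm, ← MvPolynomial.C_mul, mul_inv_cancel₀ z_ne_zero,
      map_one, one_mul]
  exact (Dvd.intro _ coord_eq.symm).trans (c.coord_dvd_coordProd hl)

theorem aeval_coord_eq_zero {g : MvPolynomial (PluckerIndex E r) ℂ} (hg : g ∈ flagIdeal E r) :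
    MvPolynomial.aeval c.coord g = 0 := by
  suffices h : c.coordProd * MvPolynomial.aeval c.coord g = 0 from
    (mul_eq_zero.mp h).resolve_left c.coordProd_ne_zero
  refine MvPolynomial.funext fun t => ?_
  rw [← MvPolynomial.coe_aeval_eq_eval, RingHom.coe_coe]
  rw [map_mul, map_zero, mul_eq_zero, or_iff_not_imp_left]
  intro ht
  rw [MvPolynomial.comp_aeval_apply]
  have mem_flagCone : (fun x => MvPolynomial.aeval t (c.coord x)) ∈ flagCone E r :=
    c.aeval_coord_mem_flagCone t fun x hx => ne_zero_of_dvd_ne_zero ht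
      (map_dvd (MvPolynomial.aeval t) (c.coord_dvd_coordProd hx))
  exact (MvPolynomial.mem_vanishingIdeal_iff ..).mp hg _ mem_flagCone

theorem exists_mul_paramHom_coordProd_pow_eq (y : stratumRing E r Q) :
    ∃ n g, y * c.paramHom c.coordProd ^ n = c.paramHom g := by
  let T : Subalgebra ℂ (stratumRing E r Q) :=
    { carrier := {y | ∃ n g, y * c.paramHom c.coordProd ^ n = c.paramHom g}
      mul_mem' := by
        rintro y z ⟨n, g, hg⟩ ⟨k, h, hh⟩
        exact ⟨n + k, g * h, by rw [pow_add, mul_mul_mul_comm, hg, hh, map_mul]⟩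
      add_mem' := by
        rintro y z ⟨n, g, hg⟩ ⟨k, h, hh⟩
        refine ⟨n + k, g * c.coordProd ^ k + h * c.coordProd ^ n, ?_⟩
        rw [map_add, map_mul, map_mul, map_pow, map_pow, ← hg, ← hh]
        ring
      algebraMap_mem' := fun z => ⟨0, MvPolynomial.C z, by
        rw [pow_zero, mul_one, MvPolynomial.algHom_C]⟩ }
  suffices h : T = ⊤ from (h.symm ▸ Algebra.mem_top : y ∈ T)
  refine eq_top_of_coordRatio_mem c.isBaseIndex_index fun i l m _ hm => ?_
  obtain ⟨g, hg⟩ := c.coord_dvd_coordProd hm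
  refine ⟨1, c.coord ⟨i, l⟩ * g, ?_⟩
  rw [pow_one, hg, map_mul, ← mul_assoc, c.coordRatio_mul_paramHom_coord hm, map_mul]

theorem exists_algHom_laurentRing_paramHom {A : Type*} [CommRing A] [Algebra ℂ A]
    {φ : MvPolynomial τ ℂ →ₐ[ℂ] A} (hφ : IsUnit (φ c.coordProd)) :
    ∃ ψ : LaurentRing E r Q →ₐ[ℂ] A, ∀ g, ψ (c.paramHom g) = φ g := by
  have isUnit_coord {x : PluckerIndex E r} (hx : IsBaseIndex Q x) : IsUnit (φ (c.coord x)) :=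
    isUnit_of_dvd_unit (map_dvd φ (c.coord_dvd_coordProd hx)) hφ
  obtain ⟨ψ, hψ⟩ := exists_algHom_laurentRing (Q := Q) (p := fun x => φ (c.coord x))
    (fun g hg => by rw [← MvPolynomial.comp_aeval_apply, c.aeval_coord_eq_zero hg, map_zero])
    (fun x hx => isUnit_coord hx)
    fun x hx => by rw [not_not.mp (mt (c.coord_ne_zero_iff x).mp hx), map_zero]
  have ψ_ratio (i) (l) : ψ (coordRatio Q i l (c.index i)) * φ (c.coord ⟨i, c.index i⟩) =
      φ (c.coord ⟨i, l⟩) := by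
    rw [← hψ, ← hψ, mul_comm, ← map_mul, laurentCoord_mul_coordRatio (c.isBaseIndex_index i)]
  have ψ_param (v : τ) : ψ (c.param v) = φ (MvPolynomial.X v) := by
    obtain ⟨i, l, m, z, -, hm, X_mul, param_mul⟩ := c.exists_X_eq_param_eq v
    refine (isUnit_coord hm).mul_right_cancel ?_
    calc ψ (c.param v) * φ (c.coord ⟨i, m⟩)
        = ψ ↑(c.param v * coordRatio Q i m (c.index i)) * φ (c.coord ⟨i, c.index i⟩) := by
          rw [← ψ_ratio, MulMemClass.coe_mul, map_mul, mul_assoc]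
      _ = z • φ (c.coord ⟨i, l⟩) := by
          rw [param_mul, ← ψ_ratio i l]
          exact (congrArg (· * φ _) (map_smul ψ z _)).trans (smul_mul_assoc _ _ _)
      _ = φ (MvPolynomial.X v) * φ (c.coord ⟨i, m⟩) := by
          rw [← map_mul, X_mul, map_mul, MvPolynomial.algHom_C, Algebra.smul_def]
  have comp_eq : (ψ.comp (stratumRing E r Q).val).comp c.paramHom = φ := by
    refine MvPolynomial.algHom_ext fun v => ?_
    rw [AlgHom.comp_apply, paramHom, MvPolynomial.aeval_X]
    exact ψ_param v
  exact ⟨ψ, DFunLike.congr_fun comp_eq⟩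

theorem isLocalizationAway_paramHom :
    let := c.paramHom.toAlgebra
    IsLocalization.Away c.coordProd (stratumRing E r Q) := by
  let := c.paramHom.toAlgebra
  let A := Localization.Away c.coordProd
  obtain ⟨ψ, ψ_paramHom⟩ := c.exists_algHom_laurentRing_paramHom
    (φ := IsScalarTower.toAlgHom ℂ (MvPolynomial τ ℂ) A)
    (IsLocalization.Away.algebraMap_isUnit c.coordProd)
  refine IsLocalization.Away.mk _ c.isUnit_paramHom_coordProd
    c.exists_mul_paramHom_coordProd_pow_eq fun g h hgh => ?_
  have ψ_eq : ψ (c.paramHom g) = ψ (c.paramHom h) :=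
    congrArg (fun y : stratumRing E r Q => ψ y) hgh
  rw [ψ_paramHom, ψ_paramHom] at ψ_eq
  exact IsLocalization.Away.exists_of_eq (S := A) c.coordProd ψ_eq

include c in
theorem irreducibleSpace : IrreducibleSpace (flagStratum E r Q) := by
  let := c.paramHom.toAlgebra
  have := c.isLocalizationAway_paramHom
  have : IsDomain (stratumRing E r Q) :=
    IsLocalization.Away.isDomain _ c.coordProd_ne_zero
  exact inferInstanceAs (IrreducibleSpace (PrimeSpectrum (stratumRing E r Q)))

variable [Finite τ]

include c in
theorem smooth : Smooth (flagStratumToSpec E r Q) := by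
  let := c.paramHom.toAlgebra
  have := c.isLocalizationAway_paramHom
  have : IsScalarTower ℂ (MvPolynomial τ ℂ) (stratumRing E r Q) :=
    .of_algebraMap_eq' c.paramHom.comp_algebraMap.symm
  have := smooth_of_isLocalizationAway_mvPolynomial (R := ℂ) (S := stratumRing E r Q) c.coordProd
  exact (HasRingHomProperty.Spec_iff (P := @Smooth)).mpr (RingHom.smooth_algebraMap.mpr this)

include c in
theorem isOpenInTorus : IsOpenInTorus E r Q := by
  let := c.paramHom.toAlgebra
  have := c.isLocalizationAway_paramHom
  have : IsScalarTower ℂ (MvPolynomial τ ℂ) (stratumRing E r Q) :=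
    .of_algebraMap_eq' c.paramHom.comp_algebraMap.symm
  exact exists_isOpenImmersion_algTorus c.X_dvd_coordProd

end StratumChart

end StratumChart

section SignedMinors

open Matrix

variable {n : ℕ}

/-- The signed maximal minors of an `n × (n + 1)` matrix, that is, the cross product of its rows. -/
def signedMinors {R : Type*} [CommRing R] (w : Matrix (Fin n) (Fin (n + 1)) R)
    (j : Fin (n + 1)) : R :=
  (-1) ^ (j : ℕ) * (w.submatrix id j.succAbove).det

theorem signedMinors_dotProduct {R : Type*} [CommRing R] (w : Matrix (Fin n) (Fin (n + 1)) R)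
    (x : Fin (n + 1) → R) : signedMinors w ⬝ᵥ x = (of (Fin.cons x w)).det := by
  rw [det_succ_row_zero]
  refine Finset.sum_congr rfl fun j _ => ?_
  rw [signedMinors, mul_right_comm]
  rfl

theorem signedMinors_dotProduct_row {R : Type*} [CommRing R] (w : Matrix (Fin n) (Fin (n + 1)) R)
    (i : Fin n) : signedMinors w ⬝ᵥ w i = 0 := by
  rw [signedMinors_dotProduct]
  exact det_zero_of_row_eq (Fin.succ_ne_zero i).symm rfl

variable {K : Type*} [Field K] {w : Matrix (Fin n) (Fin (n + 1)) K}

theorem exists_smul_signedMinors_eq {b : Fin (n + 1) → K} (hb : b ≠ 0)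
    (hw : LinearIndependent K w) (hbw : ∀ i, b ⬝ᵥ w i = 0) :
    ∃ c : K, c ≠ 0 ∧ b = c • signedMinors w := by
  obtain ⟨q, hq⟩ := Function.ne_iff.mp hb
  let y : Fin (n + 1) → K := Pi.single q 1
  have hy : b ⬝ᵥ y ≠ 0 := by simpa [y] using hq
  let M : Matrix (Fin (n + 1)) (Fin (n + 1)) K := of (Fin.cons y w)
  have det_ne_zero : M.det ≠ 0 := by
    refine isUnit_iff_ne_zero.mp ((isUnit_iff_isUnit_det M).mp ?_)
    refine linearIndependent_rows_iff_isUnit.mp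
      (linearIndependent_finCons.mpr ⟨hw, fun hmem => hy ?_⟩)
    have span_le_ker : Submodule.span K (Set.range w) ≤ LinearMap.ker (dotProductBilin K K b) :=
      Submodule.span_le.mpr (Set.range_subset_iff.mpr hbw)
    exact span_le_ker hmem
  have smul_eq : (b ⬝ᵥ y) • signedMinors w = M.det • b := by
    refine sub_eq_zero.mp
      (eq_zero_of_mulVec_eq_zero det_ne_zero (funext (Fin.cases ?_ fun i => ?_)))
    · change y ⬝ᵥ ((b ⬝ᵥ y) • signedMinors w - M.det • b) = 0
      rw [dotProduct_sub, dotProduct_smul, dotProduct_smul, dotProduct_comm y,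
        signedMinors_dotProduct, dotProduct_comm y, smul_eq_mul, smul_eq_mul, mul_comm, sub_self]
    · change w i ⬝ᵥ ((b ⬝ᵥ y) • signedMinors w - M.det • b) = 0
      rw [dotProduct_sub, dotProduct_smul, dotProduct_smul, dotProduct_comm (w i),
        signedMinors_dotProduct_row, dotProduct_comm (w i), hbw, smul_zero, smul_zero, sub_zero]
  refine ⟨M.det⁻¹ * (b ⬝ᵥ y), mul_ne_zero (inv_ne_zero det_ne_zero) hy, ?_⟩
  rw [mul_smul, smul_eq, inv_smul_smul₀ det_ne_zero]

theorem exists_basis_ker_smul_signedMinors_eq {b : Fin (n + 1) → K} (hb : b ≠ 0) :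
    ∃ w : Matrix (Fin n) (Fin (n + 1)) K, LinearIndependent K w ∧
      Submodule.span K (Set.range w) = LinearMap.ker (dotProductBilin K K b) ∧
      ∃ c : K, c ≠ 0 ∧ b = c • signedMinors w := by
  have functional_ne_zero : dotProductBilin K K b ≠ 0 := fun h =>
    hb (dotProduct_eq_zero b fun x => LinearMap.congr_fun h x)
  have finrank_ker : Module.finrank K (LinearMap.ker (dotProductBilin K K b)) = n := by
    have := Module.Dual.finrank_ker_add_one_of_ne_zero functional_ne_zero
    rwa [Module.finrank_fin_fun, add_left_inj] at this
  let basis := Module.finBasisOfFinrankEq K _ finrank_ker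
  have linearIndependent := basis.linearIndependent.map' _ (Submodule.ker_subtype _)
  refine ⟨_, linearIndependent, ?_,
    exists_smul_signedMinors_eq hb linearIndependent fun i => (basis i).2⟩
  rw [Set.range_comp, ← Submodule.map_span, basis.span_eq, Submodule.map_top,
    Submodule.range_subtype]

end SignedMinors

section FlagConeOnUniv

variable {α : Type} [LinearOrder α] {s : ℕ} {r : Fin s → ℕ}

theorem mem_flagCone_univ_iff {p : PluckerIndex (Set.univ : Set α) r → ℂ} :
    p ∈ flagCone Set.univ r ↔ ∃ v : ∀ i, Fin (r i) → α → ℂ,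
      (Monotone fun i => Submodule.span ℂ (Set.range (v i))) ∧ ∀ i, LinearIndependent ℂ (v i) ∧
      ∃ c : ℂ, c ≠ 0 ∧ ∀ l : {l : Finset (Set.univ : Set α) // l.card = r i}, p ⟨i, l⟩ =
        c * Matrix.det (Matrix.of fun m n => v i m (l.1.orderEmbOfFin l.2 n)) := by
  let e : (α → ℂ) ≃ₗ[ℂ] (↥(Set.univ : Set α) → ℂ) :=
    LinearEquiv.funCongrLeft ℂ ℂ (Equiv.Set.univ α)
  constructor
  · rintro ⟨F, hF, hp⟩
    choose b c hc hpc using hp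
    let v (i : Fin s) (m : Fin (r i)) : α → ℂ := e.symm (b i m)
    have span_eq (i) : Submodule.span ℂ (Set.range (v i)) = (F i).map e.symm.toLinearMap := by
      rw [← Submodule.range_subtype (F i), ← Submodule.map_top, ← (b i).span_eq, Submodule.map_span,
        Submodule.map_span, ← Set.range_comp, ← Set.range_comp]
      rfl
    refine ⟨v, fun i j hij => ?_, fun i => ⟨?_, c i, hc i, hpc i⟩⟩
    · simpa only [span_eq] using Submodule.map_mono (hF hij)
    · exact ((b i).linearIndependent.map' _ (F i).ker_subtype).map' _ e.symm.ker
  · rintro ⟨v, hv, h⟩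
    choose linearIndependent c hc hpc using h
    refine ⟨fun i => (Submodule.span ℂ (Set.range (v i))).map e.toLinearMap,
      fun i j hij => Submodule.map_mono (hv hij), fun i =>
        ⟨(Module.Basis.span (linearIndependent i)).map (e.submoduleMap _), c i, hc i, fun l => ?_⟩⟩
    refine (hpc i l).trans (congrArg (c i * Matrix.det ·) (Matrix.ext fun m n => ?_))
    simp [Module.Basis.span_apply, e]

end FlagConeOnUniv

section FlagIndices

/-- Indices of the Plücker coordinates of complete flags in `ℂ⁴`. -/
abbrev FlagIndex : Type := PluckerIndex (Set.univ : Set (Fin 4)) ![1, 2, 3]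

/-- The index `{j}` of a coordinate of the point of a flag. -/
def pointIndex (j : Fin 4) : FlagIndex := ⟨0, {⟨j, trivial⟩}, rfl⟩

/-- The index `{j, k}` of a coordinate of the line of a flag. -/
def lineIndex (j k : Fin 4) (h : j ≠ k) : FlagIndex :=
  ⟨1, {⟨j, trivial⟩, ⟨k, trivial⟩}, Finset.card_pair fun e => h (congrArg Subtype.val e)⟩

/-- The index `[4] ∖ {j}` of a coordinate of the plane of a flag. -/
def planeIndex (j : Fin 4) : FlagIndex :=
  ⟨2, {⟨j, trivial⟩}ᶜ, by rw [Finset.card_compl]; rfl⟩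

theorem lineIndex_comm {j k : Fin 4} (h : j ≠ k) : lineIndex j k h = lineIndex k j h.symm :=
  congrArg (Sigma.mk (1 : Fin 3)) (Subtype.ext (Finset.pair_comm _ _))

theorem flagIndex_cases {motive : FlagIndex → Prop} (point : ∀ j, motive (pointIndex j))
    (line : ∀ j k (h : j < k), motive (lineIndex j k h.ne)) (plane : ∀ j, motive (planeIndex j))
    (x : FlagIndex) : motive x := by
  obtain ⟨i, l, hl⟩ := x
  fin_cases i
  · obtain ⟨⟨j, _⟩, rfl⟩ := Finset.card_eq_one.mp hl
    exact point j
  · obtain ⟨⟨j, _⟩, ⟨k, _⟩, hjk, rfl⟩ := Finset.card_eq_two.mp hl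
    have j_ne_k : j ≠ k := fun e => hjk (Subtype.ext e)
    rcases lt_or_gt_of_ne j_ne_k with h | h
    · exact line j k h
    · have eq_lineIndex :
          (⟨1, {⟨j, trivial⟩, ⟨k, trivial⟩}, hl⟩ : FlagIndex) = lineIndex k j h.ne :=
        lineIndex_comm j_ne_k
      exact eq_lineIndex ▸ line k j h
  · have card_compl : lᶜ.card = 1 := by rw [Finset.card_compl, hl]; rfl
    obtain ⟨⟨j, _⟩, hj⟩ := Finset.card_eq_one.mp card_compl
    obtain rfl : l = {⟨j, trivial⟩}ᶜ := by rw [← hj, compl_compl]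
    exact plane j

theorem orderEmbOfFin_pointIndex (j : Fin 4) :
    (fun m => (pointIndex j).2.1.orderEmbOfFin (pointIndex j).2.2 m) =
      fun _ : Fin 1 => ⟨j, trivial⟩ :=
  funext fun m => Finset.mem_singleton.mp (Finset.orderEmbOfFin_mem _ (pointIndex j).2.2 m)

theorem orderEmbOfFin_lineIndex {j k : Fin 4} (h : j < k) :
    (fun m => (lineIndex j k h.ne).2.1.orderEmbOfFin (lineIndex j k h.ne).2.2 m) =
      fun m : Fin 2 => ⟨![j, k] m, trivial⟩ := by
  refine (Finset.orderEmbOfFin_unique (lineIndex j k h.ne).2.2 (fun m => ?_)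
    (Fin.strictMono_iff_lt_succ (n := 1).mpr fun m => ?_)).symm
  · fin_cases m <;> simp [lineIndex]
  · obtain rfl := Subsingleton.elim m 0
    exact h

theorem orderEmbOfFin_planeIndex (j : Fin 4) :
    (fun m => (planeIndex j).2.1.orderEmbOfFin (planeIndex j).2.2 m) =
      fun m : Fin 3 => ⟨j.succAbove m, trivial⟩ := by
  refine (Finset.orderEmbOfFin_unique (planeIndex j).2.2 (fun m => ?_) fun m n hmn => ?_).symm
  · simpa [planeIndex] using fun e => Fin.succAbove_ne j m (congrArg Subtype.val e)
  · exact Fin.strictMono_succAbove j hmn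

end FlagIndices

section FlagCoordinates

variable {A B : Type*} [CommRing A] [CommRing B]

/-- The coordinates of the point of a flag. -/
def pointCoord (π : FlagIndex → A) (j : Fin 4) : A := π (pointIndex j)

/-- The coordinates of the line of a flag, as an alternating matrix. -/
def lineCoord (π : FlagIndex → A) : Matrix (Fin 4) (Fin 4) A := fun j k =>
  if h : j ≠ k then ((k - j : ℤ).sign : A) * π (lineIndex j k h) else 0

/-- The coordinates of the plane of a flag, as the coefficients of a linear equation of the
plane. -/
def planeCoord (π : FlagIndex → A) (j : Fin 4) : A := (-1) ^ (j : ℕ) * π (planeIndex j)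

theorem lineCoord_of_lt (π : FlagIndex → A) {j k : Fin 4} (h : j < k) :
    lineCoord π j k = π (lineIndex j k h.ne) := by
  have sign_eq : (k - j : ℤ).sign = 1 := Int.sign_eq_one_of_pos (by omega)
  rw [lineCoord, dif_pos h.ne, sign_eq, Int.cast_one, one_mul]

theorem lineCoord_self (π : FlagIndex → A) (j : Fin 4) : lineCoord π j j = 0 :=
  dif_neg (not_not_intro rfl)

theorem lineCoord_swap (π : FlagIndex → A) (j k : Fin 4) : lineCoord π k j = -lineCoord π j k := by
  rcases eq_or_ne j k with rfl | h
  · rw [lineCoord_self, neg_zero]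
  · rw [lineCoord, lineCoord, dif_pos h, dif_pos h.symm, lineIndex_comm h, ← neg_sub, Int.sign_neg,
      Int.cast_neg, neg_mul]

theorem comp_pointCoord (φ : A →+* B) (π : FlagIndex → A) :
    φ ∘ pointCoord π = pointCoord (φ ∘ π) := rfl

theorem map_lineCoord (φ : A →+* B) (π : FlagIndex → A) :
    (lineCoord π).map φ = lineCoord (φ ∘ π) := by
  ext j k
  rw [Matrix.map_apply, lineCoord, lineCoord]
  split_ifs <;> simp

theorem comp_planeCoord (φ : A →+* B) (π : FlagIndex → A) :
    φ ∘ planeCoord π = planeCoord (φ ∘ π) :=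
  funext fun j => by simp [planeCoord]

theorem pointCoord_smul (c : Fin 3 → A) (π : FlagIndex → A) :
    pointCoord (fun x => c x.1 * π x) = c 0 • pointCoord π := rfl

theorem lineCoord_smul (c : Fin 3 → A) (π : FlagIndex → A) :
    lineCoord (fun x => c x.1 * π x) = c 1 • lineCoord π := by
  ext j k
  simp only [lineCoord, Matrix.smul_apply, smul_eq_mul, mul_dite, mul_zero]
  exact dite_congr rfl (fun _ => mul_left_comm _ _ _) fun _ => rfl

theorem planeCoord_smul (c : Fin 3 → A) (π : FlagIndex → A) :
    planeCoord (fun x => c x.1 * π x) = c 2 • planeCoord π :=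
  funext fun _ => mul_left_comm _ _ _

theorem flagIndex_funext {π ρ : FlagIndex → A} (point : pointCoord π = pointCoord ρ)
    (line : lineCoord π = lineCoord ρ) (plane : planeCoord π = planeCoord ρ) : π = ρ := by
  refine funext (flagIndex_cases (fun j => congrFun point j) (fun j k h => ?_) fun j => ?_)
  · simpa only [lineCoord_of_lt _ h] using congrFun₂ line j k
  · exact ((isUnit_one.neg.pow (j : ℕ)).mul_right_inj).mp (congrFun plane j)

/-- Point `a`, line `P` and plane `b` as a family indexed by `FlagIndex`; the sums have only one
term. -/
def flagCoords (a : Fin 4 → A) (P : Matrix (Fin 4) (Fin 4) A) (b : Fin 4 → A) : FlagIndex → A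
  | ⟨0, l⟩ => ∑ j ∈ l.1, a j
  | ⟨1, l⟩ => P (l.1.orderEmbOfFin l.2 (0 : Fin 2)) (l.1.orderEmbOfFin l.2 (1 : Fin 2))
  | ⟨2, l⟩ => ∑ j ∈ l.1ᶜ, (-1) ^ (j : ℕ) * b j

theorem pointCoord_flagCoords (a : Fin 4 → A) (P : Matrix (Fin 4) (Fin 4) A) (b : Fin 4 → A) :
    pointCoord (flagCoords a P b) = a := funext fun _ => Finset.sum_singleton _ _

theorem planeCoord_flagCoords (a : Fin 4 → A) (P : Matrix (Fin 4) (Fin 4) A) (b : Fin 4 → A) :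
    planeCoord (flagCoords a P b) = b := by
  ext j
  have coord : flagCoords a P b (planeIndex j) = (-1) ^ (j : ℕ) * b j := by
    simp [flagCoords, planeIndex]
  rw [planeCoord, coord, ← mul_assoc, ← mul_pow, neg_one_mul, neg_neg, one_pow, one_mul]

/-- The maximal minors of a `1 × 4`, a `2 × 4` and a `3 × 4` matrix. -/
def flagMinors (v : ∀ i : Fin 3, Fin (![1, 2, 3] i) → Fin 4 → A) (x : FlagIndex) : A :=
  Matrix.det (Matrix.of fun m n => v x.1 m (x.2.1.orderEmbOfFin x.2.2 n))

theorem pointCoord_flagMinors (v : ∀ i : Fin 3, Fin (![1, 2, 3] i) → Fin 4 → A) :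
    pointCoord (flagMinors v) = v 0 (0 : Fin 1) := by
  ext j
  have minor := congrArg (fun f : Fin 1 → (Set.univ : Set (Fin 4)) =>
    Matrix.det (Matrix.of fun m n => v 0 m (f n))) (orderEmbOfFin_pointIndex j)
  exact minor.trans (Matrix.det_fin_one _)

theorem planeCoord_flagMinors (v : ∀ i : Fin 3, Fin (![1, 2, 3] i) → Fin 4 → A) :
    planeCoord (flagMinors v) = signedMinors (n := 3) (v 2) := by
  ext j
  have minor := congrArg (fun f : Fin 3 → (Set.univ : Set (Fin 4)) =>
    Matrix.det (Matrix.of fun m n => v 2 m (f n))) (orderEmbOfFin_planeIndex j)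
  unfold planeCoord signedMinors
  exact congrArg ((-1) ^ (j : ℕ) * ·) minor

theorem comp_flagCoords (φ : A →+* B) (a : Fin 4 → A) (P : Matrix (Fin 4) (Fin 4) A)
    (b : Fin 4 → A) : φ ∘ flagCoords a P b = flagCoords (φ ∘ a) (P.map φ) (φ ∘ b) := by
  ext ⟨i, l⟩
  fin_cases i <;> simp [flagCoords]

end FlagCoordinates

section Incidence

open Matrix

variable {A ι : Type*} [CommRing A]

/-- An alternating matrix: the coordinates of an element of `⋀² A^ι`. -/
structure IsAlternating (P : Matrix ι ι A) : Prop where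
  self : ∀ j, P j j = 0
  swap : ∀ j k, P k j = -P j k

/-- The relation `a ∧ P = 0` between `a : A^ι` and `P : ⋀² A^ι`. -/
def Incident (a : ι → A) (P : Matrix ι ι A) : Prop :=
  ∀ i j k, a i * P j k - a j * P i k + a k * P i j = 0

/-- The Plücker relations: the coordinates `P` are, up to scalars, those of a line, and then the
rows of `P` are points of that line. -/
structure IsDecomposable (P : Matrix ι ι A) : Prop where
  isAlternating : IsAlternating P
  incident_row : ∀ j, Incident (P j) P

/-- The coordinates of the line through `u` and `w`. -/
def wedge (u w : ι → A) : Matrix ι ι A := fun j k => u j * w k - w j * u k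

theorem isAlternating_wedge (u w : ι → A) : IsAlternating (wedge u w) :=
  ⟨fun j => by simp only [wedge]; ring, fun j k => by simp only [wedge]; ring⟩

theorem incident_wedge (c d : A) (u w : ι → A) : Incident (c • u + d • w) (wedge u w) :=
  fun i j k => by simp only [wedge, Pi.add_apply, Pi.smul_apply, smul_eq_mul]; ring

theorem isDecomposable_wedge (u w : ι → A) : IsDecomposable (wedge u w) where
  isAlternating := isAlternating_wedge u w
  incident_row j := by
    have row_eq : wedge u w j = (-w j) • u + u j • w :=
      funext fun k => by simp only [wedge, Pi.add_apply, Pi.smul_apply, smul_eq_mul]; ring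
    rw [row_eq]
    exact incident_wedge _ _ u w

theorem wedge_mulVec [Fintype ι] (u w b : ι → A) :
    wedge u w *ᵥ b = (w ⬝ᵥ b) • u - (u ⬝ᵥ b) • w := by
  ext j
  simp only [mulVec, dotProduct, wedge, Pi.sub_apply, Pi.smul_apply, smul_eq_mul, Finset.sum_mul,
    sub_mul, Finset.sum_sub_distrib]
  congr 1 <;> exact Finset.sum_congr rfl fun k _ => by ring

theorem Incident.smul {a : ι → A} {P : Matrix ι ι A} (h : Incident a P) (c d : A) :
    Incident (c • a) (d • P) := fun i j k => by
  simp only [Pi.smul_apply, Matrix.smul_apply, smul_eq_mul]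
  linear_combination c * d * h i j k

theorem IsDecomposable.incident_smul_row_sub_row {P : Matrix ι ι A} (hP : IsDecomposable P)
    (i r : ι) (c : A) : Incident (c • P i - P r) P := fun j k l => by
  simp only [Pi.sub_apply, Pi.smul_apply, smul_eq_mul]
  linear_combination c * hP.incident_row i j k l - hP.incident_row r j k l

theorem Incident.smul_eq {a : ι → A} {P : Matrix ι ι A} (h : Incident a P) (hP : IsAlternating P)
    (i r : ι) : P i r • a = a r • P i - a i • P r := funext fun j => by
  simp only [Pi.smul_apply, Pi.sub_apply, smul_eq_mul]
  linear_combination h j i r - a r * hP.swap i j + a i * hP.swap r j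

theorem IsDecomposable.smul_eq_wedge {P : Matrix ι ι A} (hP : IsDecomposable P) (i r : ι) :
    P i r • P = wedge (P i) (P r) := by
  ext j k
  rw [wedge, Matrix.smul_apply, smul_eq_mul]
  linear_combination P i k * hP.isAlternating.swap r j - hP.incident_row i j r k

/-- The pair `(l, m)` for which `(j, k, l, m)` is an even permutation of `(0, 1, 2, 3)`; the pairs
`(j, j)` are fixed. -/
def hodge (j k : Fin 4) : Fin 4 × Fin 4 :=
  !![(0, 0), (2, 3), (3, 1), (1, 2);
     (3, 2), (1, 1), (0, 3), (2, 0);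
     (1, 3), (3, 0), (2, 2), (0, 1);
     (2, 1), (0, 2), (1, 0), (3, 3)] j k

/-- The Hodge star on `⋀² A⁴`; it exchanges the Plücker coordinates of a line with those of the
pencil of planes containing it. -/
def hodgeStar {A : Type*} (P : Matrix (Fin 4) (Fin 4) A) : Matrix (Fin 4) (Fin 4) A := fun j k =>
  P (hodge j k).1 (hodge j k).2

theorem map_hodgeStar {A B : Type*} (f : A → B) (P : Matrix (Fin 4) (Fin 4) A) :
    (hodgeStar P).map f = hodgeStar (P.map f) := rfl

theorem hodge_swap (j k : Fin 4) : hodge k j = (hodge j k).swap := by decide +revert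

theorem hodge_hodge (j k : Fin 4) : hodge (hodge j k).1 (hodge j k).2 = (j, k) := by decide +revert

theorem hodge_self (j : Fin 4) : hodge j j = (j, j) := by decide +revert

theorem hodgeStar_hodgeStar {A : Type*} (P : Matrix (Fin 4) (Fin 4) A) :
    hodgeStar (hodgeStar P) = P := by
  ext j k
  rw [hodgeStar, hodgeStar, hodge_hodge]

theorem IsAlternating.hodgeStar {P : Matrix (Fin 4) (Fin 4) A} (hP : IsAlternating P) :
    IsAlternating (hodgeStar P) where
  self j := by rw [_root_.hodgeStar, hodge_self, hP.self]
  swap j k := by rw [_root_.hodgeStar, _root_.hodgeStar, hodge_swap, hP.swap]; rfl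

theorem incident_of_lt {a : Fin 4 → A} {P : Matrix (Fin 4) (Fin 4) A} (hP : IsAlternating P)
    (h : ∀ i j k, i < j → j < k → a i * P j k - a j * P i k + a k * P i j = 0) : Incident a P := by
  intro i j k
  rcases lt_trichotomy i j with hij | hij | hij <;>
    rcases lt_trichotomy j k with hjk | hjk | hjk <;>
    rcases lt_trichotomy i k with hik | hik | hik <;> grind [hP.self, hP.swap]

theorem incident_hodgeStar_iff {b : Fin 4 → A} {P : Matrix (Fin 4) (Fin 4) A}
    (hP : IsAlternating P) : Incident b (hodgeStar P) ↔ P *ᵥ b = 0 := by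
  constructor
  · intro h
    ext i
    have h₀ := h 1 2 3
    have h₁ := h 0 2 3
    have h₂ := h 0 1 3
    have h₃ := h 0 1 2
    simp only [hodgeStar, hodge, of_apply, cons_val] at h₀ h₁ h₂ h₃
    simp only [mulVec, dotProduct, Fin.sum_univ_four, Pi.zero_apply]
    fin_cases i <;> grind [hP.self, hP.swap]
  · intro h
    have row := fun i => congrFun h i
    simp only [mulVec, dotProduct, Fin.sum_univ_four, Pi.zero_apply] at row
    refine incident_of_lt hP.hodgeStar fun i j k hij hjk => ?_
    simp only [hodgeStar]
    fin_cases i <;> fin_cases j <;> fin_cases k <;> simp [hodge] at hij hjk ⊢ <;>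
      grind [hP.self, hP.swap]

theorem IsDecomposable.hodgeStar {P : Matrix (Fin 4) (Fin 4) A} (hP : IsDecomposable P) :
    IsDecomposable (hodgeStar P) where
  isAlternating := hP.isAlternating.hodgeStar
  incident_row j := by
    refine (incident_hodgeStar_iff hP.isAlternating).mpr (funext fun i => ?_)
    have row := hP.incident_row i
    rw [← hodgeStar_hodgeStar P, incident_hodgeStar_iff hP.isAlternating.hodgeStar,
      hodgeStar_hodgeStar] at row
    simpa only [mulVec, dotProduct_comm, Pi.zero_apply] using congrFun row j

/-- The incidence relations and the Plücker relation between the coordinates of the point, the line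
and the plane of a flag. -/
structure PluckerRelations (a : Fin 4 → A) (P : Matrix (Fin 4) (Fin 4) A) (b : Fin 4 → A) :
    Prop where
  isDecomposable : IsDecomposable P
  incident_point : Incident a P
  incident_plane : Incident b (hodgeStar P)

namespace PluckerRelations

variable {a b : Fin 4 → A} {P : Matrix (Fin 4) (Fin 4) A}

theorem smul (h : PluckerRelations a P b) (c d e : A) :
    PluckerRelations (c • a) (d • P) (e • b) where
  isDecomposable :=
    { isAlternating := ⟨fun j => by simp [h.isDecomposable.isAlternating.self],
        fun j k => by simp [h.isDecomposable.isAlternating.swap j k]⟩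
      incident_row := fun j => (h.isDecomposable.incident_row j).smul d d }
  incident_point := h.incident_point.smul c d
  incident_plane := h.incident_plane.smul e d

theorem map {B : Type*} [CommRing B] (φ : A →+* B) (h : PluckerRelations a P b) :
    PluckerRelations (φ ∘ a) (P.map φ) (φ ∘ b) where
  isDecomposable :=
    { isAlternating := ⟨fun j => by simp [h.isDecomposable.isAlternating.self],
        fun j k => by simp [h.isDecomposable.isAlternating.swap j k]⟩
      incident_row := fun l i j k => by
        simpa using congrArg φ (h.isDecomposable.incident_row l i j k) }
  incident_point i j k := by simpa using congrArg φ (h.incident_point i j k)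
  incident_plane i j k := by simpa [hodgeStar] using congrArg φ (h.incident_plane i j k)

theorem of_forall_map {ι : Type*} {B : ι → Type*} [∀ i, CommRing (B i)] (φ : ∀ i, A →+* B i)
    (eq_zero : ∀ x, (∀ i, φ i x = 0) → x = 0)
    (h : ∀ i, PluckerRelations (φ i ∘ a) (P.map (φ i)) (φ i ∘ b)) : PluckerRelations a P b where
  isDecomposable :=
    { isAlternating :=
        ⟨fun j => eq_zero _ fun i => (h i).isDecomposable.isAlternating.self j,
          fun j k => eq_neg_of_add_eq_zero_left (eq_zero _ fun i => by
            simpa [eq_neg_iff_add_eq_zero] using (h i).isDecomposable.isAlternating.swap j k)⟩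
      incident_row := fun m j k l => eq_zero _ fun i => by
        simpa using (h i).isDecomposable.incident_row m j k l }
  incident_point j k l := eq_zero _ fun i => by simpa using (h i).incident_point j k l
  incident_plane j k l := eq_zero _ fun i => by
    simpa [hodgeStar] using (h i).incident_plane j k l

end PluckerRelations

theorem pluckerRelations_wedge {u w b : Fin 4 → A} (c d : A) (hu : u ⬝ᵥ b = 0) (hw : w ⬝ᵥ b = 0) :
    PluckerRelations (c • u + d • w) (wedge u w) b where
  isDecomposable := isDecomposable_wedge u w
  incident_point := incident_wedge c d u w
  incident_plane := by
    rw [incident_hodgeStar_iff (isAlternating_wedge u w), wedge_mulVec, hu, hw, zero_smul,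
      zero_smul, sub_zero]

end Incidence

section PluckerRelationsOfFamily

/-- The incidence and Plücker relations among the coordinates of a family indexed by `FlagIndex`. -/
def SatisfiesPluckerRelations {A : Type*} [CommRing A] (π : FlagIndex → A) : Prop :=
  PluckerRelations (pointCoord π) (lineCoord π) (planeCoord π)

namespace SatisfiesPluckerRelations

variable {A : Type*} [CommRing A] {π : FlagIndex → A}

theorem comp {B : Type*} [CommRing B] (φ : A →+* B) (h : SatisfiesPluckerRelations π) :
    SatisfiesPluckerRelations (φ ∘ π) := by
  simpa only [SatisfiesPluckerRelations, comp_pointCoord, map_lineCoord, comp_planeCoord]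
    using PluckerRelations.map φ h

theorem of_forall_comp {ι : Type*} {B : ι → Type*} [∀ i, CommRing (B i)] (φ : ∀ i, A →+* B i)
    (eq_zero : ∀ x, (∀ i, φ i x = 0) → x = 0) (h : ∀ i, SatisfiesPluckerRelations (φ i ∘ π)) :
    SatisfiesPluckerRelations π :=
  PluckerRelations.of_forall_map φ eq_zero fun i => by
    simpa only [SatisfiesPluckerRelations, comp_pointCoord, map_lineCoord, comp_planeCoord]
      using h i

theorem smul (h : SatisfiesPluckerRelations π) (c : Fin 3 → A) :
    SatisfiesPluckerRelations fun x => c x.1 * π x := by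
  rw [SatisfiesPluckerRelations, pointCoord_smul, lineCoord_smul, planeCoord_smul]
  exact PluckerRelations.smul h _ _ _

end SatisfiesPluckerRelations

end PluckerRelationsOfFamily

section LineCoordinates

variable {A : Type*} [CommRing A]

theorem isAlternating_lineCoord (π : FlagIndex → A) : IsAlternating (lineCoord π) :=
  ⟨lineCoord_self π, lineCoord_swap π⟩

theorem IsAlternating.ext {P Q : Matrix (Fin 4) (Fin 4) A} (hP : IsAlternating P)
    (hQ : IsAlternating Q) (h : ∀ j k, j < k → P j k = Q j k) : P = Q := by
  ext j k
  rcases lt_trichotomy j k with hjk | rfl | hjk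
  · exact h j k hjk
  · rw [hP.self, hQ.self]
  · rw [hP.swap k j, hQ.swap k j, h k j hjk]

theorem lineCoord_flagCoords (a : Fin 4 → A) {P : Matrix (Fin 4) (Fin 4) A} (hP : IsAlternating P)
    (b : Fin 4 → A) : lineCoord (flagCoords a P b) = P := by
  refine (isAlternating_lineCoord _).ext hP fun j k h => ?_
  rw [lineCoord_of_lt _ h]
  exact congrArg (fun f : Fin 2 → (Set.univ : Set (Fin 4)) => P (f 0) (f 1))
    (orderEmbOfFin_lineIndex h)

theorem lineCoord_flagMinors (v : ∀ i : Fin 3, Fin (![1, 2, 3] i) → Fin 4 → A) :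
    lineCoord (flagMinors v) = wedge (v 1 (0 : Fin 2)) (v 1 (1 : Fin 2)) := by
  refine (isAlternating_lineCoord _).ext (isAlternating_wedge _ _) fun j k h => ?_
  rw [lineCoord_of_lt _ h]
  have minor := congrArg (fun f : Fin 2 → (Set.univ : Set (Fin 4)) =>
    Matrix.det (Matrix.of fun m n => v 1 m (f n))) (orderEmbOfFin_lineIndex h)
  refine minor.trans ((Matrix.det_fin_two _).trans ?_)
  rw [wedge, mul_comm (v 1 (1 : Fin 2) j)]
  rfl

variable {K : Type*} [Field K] {P : Matrix (Fin 4) (Fin 4) K} {i r : Fin 4}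

theorem IsAlternating.linearIndependent_rows (hP : IsAlternating P) (hir : P i r ≠ 0) :
    LinearIndependent K ![P i, P r] := by
  refine LinearIndependent.pair_iff.mpr fun c d h => ?_
  have at_r := congrFun h r
  have at_i := congrFun h i
  simp only [Pi.add_apply, Pi.smul_apply, Pi.zero_apply, hP.self, hP.swap i r, smul_neg, smul_zero,
    add_zero, zero_add, neg_eq_zero, smul_eq_zero_iff_left hir] at at_r at_i
  exact ⟨at_r, at_i⟩

theorem Incident.mem_span_rows {a : Fin 4 → K} (h : Incident a P) (hP : IsAlternating P)
    (hir : P i r ≠ 0) : a ∈ Submodule.span K (Set.range ![P i, P r]) := by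
  rw [← Submodule.smul_mem_iff _ hir, h.smul_eq hP]
  exact sub_mem (Submodule.smul_mem _ _ (Submodule.subset_span ⟨0, rfl⟩))
    (Submodule.smul_mem _ _ (Submodule.subset_span ⟨1, rfl⟩))

end LineCoordinates

section FlagCone

open Matrix

theorem satisfiesPluckerRelations_of_mem_flagCone {p : FlagIndex → ℂ}
    (hp : p ∈ flagCone Set.univ ![1, 2, 3]) :
    SatisfiesPluckerRelations p := by
  obtain ⟨v, hv, h⟩ := mem_flagCone_univ_iff.mp hp
  choose _ c _ minors using h
  have p_eq : p = fun x => c x.1 * flagMinors v x := funext fun x => minors x.1 x.2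
  rw [p_eq]
  refine SatisfiesPluckerRelations.smul ?_ c
  rw [SatisfiesPluckerRelations, pointCoord_flagMinors, lineCoord_flagMinors, planeCoord_flagMinors]
  have subset_line := hv (show (0 : Fin 3) ≤ 1 by decide)
  have subset_plane := hv (show (1 : Fin 3) ≤ 2 by decide)
  obtain ⟨y, hy⟩ := (Submodule.mem_span_range_iff_exists_fun ℂ).mp
    (subset_line (Submodule.subset_span (Set.mem_range_self (0 : Fin 1))))
  have plane_le : Submodule.span ℂ (Set.range (v 2)) ≤
      LinearMap.ker (dotProductBilin ℂ ℂ (signedMinors (n := 3) (v 2))) :=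
    Submodule.span_le.mpr (Set.range_subset_iff.mpr (signedMinors_dotProduct_row (n := 3) (v 2)))
  have dotProduct_line (m : Fin 2) : v 1 m ⬝ᵥ signedMinors (n := 3) (v 2) = 0 :=
    (dotProduct_comm _ _).trans
      (plane_le (subset_plane (Submodule.subset_span (Set.mem_range_self m))))
  rw [← (Fin.sum_univ_two _).symm.trans hy]
  exact pluckerRelations_wedge _ _ (dotProduct_line 0) (dotProduct_line 1)

theorem mem_flagCone_of_satisfiesPluckerRelations {p : FlagIndex → ℂ}
    (h : SatisfiesPluckerRelations p) (point : pointCoord p ≠ 0)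
    (line : lineCoord p ≠ 0) (plane : planeCoord p ≠ 0) : p ∈ flagCone Set.univ ![1, 2, 3] := by
  set a := pointCoord p
  set P := lineCoord p
  obtain ⟨i, hi⟩ := Function.ne_iff.mp line
  obtain ⟨r, P_ne_zero⟩ := Function.ne_iff.mp hi
  obtain ⟨w, linearIndependent_w, span_w, c, c_ne_zero, plane_eq⟩ :=
    exists_basis_ker_smul_signedMinors_eq plane
  let v : ∀ i : Fin 3, Fin (![1, 2, 3] i) → Fin 4 → ℂ
    | 0 => fun _ => a
    | 1 => ![P i, P r]
    | 2 => w
  have row_mem (j : Fin 4) : P j ∈ Submodule.span ℂ (Set.range w) := by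
    rw [span_w]
    have := (incident_hodgeStar_iff h.isDecomposable.isAlternating).mp h.incident_plane
    exact (dotProduct_comm _ _).trans (congrFun this j)
  have monotone_span : Monotone fun i => Submodule.span ℂ (Set.range (v i)) := by
    refine Fin.monotone_iff_le_succ.mpr (Fin.forall_fin_two.mpr ⟨?_, ?_⟩)
    · exact Submodule.span_le.mpr (Set.range_subset_iff.mpr fun _ =>
        h.incident_point.mem_span_rows h.isDecomposable.isAlternating P_ne_zero)
    · exact Submodule.span_le.mpr (Set.range_subset_iff.mpr
        (Fin.forall_fin_two.mpr ⟨row_mem i, row_mem r⟩))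
  have linearIndependent_v : ∀ i, LinearIndependent ℂ (v i)
    | 0 => LinearIndependent.of_subsingleton (v := fun _ : Fin 1 => a) 0 point
    | 1 => h.isDecomposable.isAlternating.linearIndependent_rows P_ne_zero
    | 2 => linearIndependent_w
  have scalar_ne_zero : ∀ j : Fin 3, ![1, (P i r)⁻¹, c] j ≠ 0
    | 0 => one_ne_zero
    | 1 => inv_ne_zero P_ne_zero
    | 2 => c_ne_zero
  have p_eq : p = fun x => ![1, (P i r)⁻¹, c] x.1 * flagMinors v x := by
    refine flagIndex_funext ?_ ?_ ?_
    · rw [pointCoord_smul, pointCoord_flagMinors]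
      exact (one_smul _ _).symm
    · rw [lineCoord_smul, lineCoord_flagMinors]
      exact (eq_inv_smul_iff₀ P_ne_zero).mpr (h.isDecomposable.smul_eq_wedge i r)
    · rw [planeCoord_smul, planeCoord_flagMinors]
      exact plane_eq
  exact mem_flagCone_univ_iff.mpr ⟨v, monotone_span, fun i =>
    ⟨linearIndependent_v i, _, scalar_ne_zero i, fun l => congrFun p_eq ⟨i, l⟩⟩⟩

end FlagCone

section Stratum

variable {Q : Fin 3 → Matroid (Fin 4)}

theorem satisfiesPluckerRelations_laurentCoord :
    SatisfiesPluckerRelations (laurentCoord (E := Set.univ) (r := ![1, 2, 3]) Q) := by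
  let I := flagIdeal (Set.univ : Set (Fin 4)) ![1, 2, 3]
  let eval (p : flagCone (Set.univ : Set (Fin 4)) ![1, 2, 3]) : _ ⧸ I →+* ℂ :=
    Ideal.Quotient.lift I (MvPolynomial.aeval p.1).toRingHom fun g hg => hg p.1 p.2
  let toLaurent : _ ⧸ I →+* LaurentRing Set.univ ![1, 2, 3] Q :=
    Ideal.Quotient.lift I (MvPolynomial.aeval (laurentCoord Q)).toRingHom
      fun g hg => aeval_laurentCoord_eq_zero hg
  have relations : SatisfiesPluckerRelations fun x => Ideal.Quotient.mk I (MvPolynomial.X x) := by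
    refine .of_forall_comp eval (fun g hg => ?_) fun p => ?_
    · obtain ⟨g, rfl⟩ := Ideal.Quotient.mk_surjective g
      exact Ideal.Quotient.eq_zero_iff_mem.mpr fun p hp => hg ⟨p, hp⟩
    · convert satisfiesPluckerRelations_of_mem_flagCone p.2
      exact funext fun x => MvPolynomial.aeval_X (R := ℂ) p.1 x
  convert relations.comp toLaurent
  exact funext fun x => (MvPolynomial.aeval_X (R := ℂ) (laurentCoord Q) x).symm

theorem satisfiesPluckerRelations_coordRatio
    (index : ∀ i, {l : Finset (Set.univ : Set (Fin 4)) // l.card = ![1, 2, 3] i}) :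
    SatisfiesPluckerRelations fun x => coordRatio Q x.1 x.2 (index x.1) := by
  refine .of_forall_comp (fun _ : Unit => (stratumRing Set.univ ![1, 2, 3] Q).val.toRingHom)
    (fun g hg => Subtype.ext (hg ())) fun _ => ?_
  convert satisfiesPluckerRelations_laurentCoord.smul
    fun i => Ring.inverse (laurentCoord Q ⟨i, index i⟩) using 1
  exact funext fun x => mul_comm _ _

end Stratum

section LineChart

variable {ι A : Type*} [CommRing A]

/-- The exchange property of the graph whose edges are the bases of a matroid of rank 2. It says
that nonadjacency is an equivalence relation on the vertices which are not isolated; the class of a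
vertex is the complement of its set of neighbours. -/
def HasExchange (G : SimpleGraph ι) : Prop :=
  ∀ ⦃i j k l⦄, G.Adj i j → G.Adj k l → G.Adj i k ∨ G.Adj i l

theorem HasExchange.neighborSet_eq {G : SimpleGraph ι} (hG : HasExchange G) {i j k r : ι}
    (hj : G.Adj j i) (hk : G.Adj k r) (hjk : ¬G.Adj j k) : G.neighborSet j = G.neighborSet k :=
  Set.ext fun _ => ⟨fun hl => (hG hk hl).resolve_left fun h => hjk h.symm,
    fun hl => (hG hj hl).resolve_left hjk⟩

open Classical in
/-- The first row of the `2 × n` matrix of a line with bases `G` whose column `i` is `(1, 0)` and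
whose column `r` is `(0, 1)`; column `j` is `m j` times `(1, s C)`, `(1, 0)` or `(0, 1)`, where `C`
is the neighbour set of `j`. -/
noncomputable def firstCoord (G : SimpleGraph ι) (r : ι) (m : ι → A) (j : ι) : A :=
  if G.Adj j r then m j else 0

open Classical in
/-- The second row of the matrix described at `firstCoord`. -/
noncomputable def secondCoord (G : SimpleGraph ι) (i r : ι) (m : ι → A) (s : Set ι → A) (j : ι) :
    A :=
  if G.Adj i j then m j * (if G.Adj j r then s (G.neighborSet j) else 1) else 0

/-- The `2 × 2` minors of the matrix described at `firstCoord`: the lines with bases `G`, normalized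
in the frame `i, r`. -/
noncomputable def lineCoords (G : SimpleGraph ι) (i r : ι) (m : ι → A) (s : Set ι → A) :
    Matrix ι ι A :=
  wedge (firstCoord G r m) (secondCoord G i r m s)

variable {G : SimpleGraph ι} {i r : ι} {m : ι → A} {s : Set ι → A}

theorem map_lineCoords {B : Type*} [CommRing B] (φ : A →+* B) :
    (lineCoords G i r m s).map φ = lineCoords G i r (φ ∘ m) (φ ∘ s) := by
  ext j k
  simp only [lineCoords, wedge, firstCoord, secondCoord, Matrix.map_apply, Function.comp_apply,
    map_sub, map_mul, apply_ite φ, map_zero, map_one]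

theorem lineCoords_left (hir : G.Adj i r) (hm : m i = 1) (j : ι) :
    lineCoords G i r m s i j = secondCoord G i r m s j := by
  simp [lineCoords, wedge, firstCoord, secondCoord, hir, hm]

theorem lineCoords_right (hir : G.Adj i r) (hm : m r = 1) (j : ι) :
    lineCoords G i r m s j r = firstCoord G r m j := by
  simp [lineCoords, wedge, firstCoord, secondCoord, hir, hm]

theorem lineCoords_ne_zero_iff [IsDomain A] (hG : HasExchange G) (hir : G.Adj i r)
    (hm : ∀ j, m j ≠ 0) (hs : ∀ C, s C ≠ 0)
    (hs' : ∀ j k, G.Adj i j → G.Adj j r → G.Adj i k → G.Adj k r →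
      s (G.neighborSet j) = s (G.neighborSet k) → G.neighborSet j = G.neighborSet k) (j k : ι) :
    lineCoords G i r m s j k ≠ 0 ↔ G.Adj j k := by
  have of_adj (hjk : G.Adj j k) : (G.Adj i j ∨ G.Adj i k) ∧ (G.Adj j r ∨ G.Adj k r) ∧
      (G.Adj i j ∨ G.Adj j r) ∧ (G.Adj i k ∨ G.Adj k r) :=
    ⟨hG hir hjk, (hG hir.symm hjk).imp .symm .symm, (hG hjk hir).imp_left .symm,
      (hG hjk.symm hir).imp_left .symm⟩
  have adj_or_left (hij : G.Adj i j) (hkr : G.Adj k r) : (G.Adj j k ∨ G.Adj j r) ∧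
      (G.Adj j k ∨ G.Adj i k) :=
    ⟨hG hij.symm hkr, (hG hkr hij).symm.imp .symm .symm⟩
  have adj_or_right (hjr : G.Adj j r) (hik : G.Adj i k) : (G.Adj j k ∨ G.Adj i j) ∧
      (G.Adj j k ∨ G.Adj k r) :=
    ⟨(hG hjr hik.symm).imp_right .symm, (hG hik.symm hjr).imp_left .symm⟩
  by_cases frame : (G.Adj i j ∧ G.Adj j r) ∧ G.Adj i k ∧ G.Adj k r
  · obtain ⟨⟨hij, hjr⟩, hik, hkr⟩ := frame
    have coord_eq : lineCoords G i r m s j k =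
        m j * m k * (s (G.neighborSet k) - s (G.neighborSet j)) := by
      simp only [lineCoords, wedge, firstCoord, secondCoord, if_pos hij, if_pos hjr, if_pos hik,
        if_pos hkr]
      ring
    rw [coord_eq, mul_ne_zero_iff_left (mul_ne_zero (hm j) (hm k)), sub_ne_zero, ← not_iff_not,
      not_ne_iff]
    refine ⟨fun h hjk => ?_, fun h => (congrArg s (hG.neighborSet_eq hjr hkr h)).symm⟩
    exact G.irrefl (hs' k j hik hkr hij hjr h ▸ hjk.symm : j ∈ G.neighborSet j)
  · simp only [lineCoords, wedge, firstCoord, secondCoord]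
    split_ifs <;>
      simp only [hm, hs, mul_zero, zero_mul, sub_zero, zero_sub, mul_one, neg_eq_zero, mul_eq_zero,
        ne_eq, or_self, not_true, not_false_iff, true_iff, false_iff] <;>
      grind

theorem IsDecomposable.smul_lineCoords_eq {P : Matrix ι ι A} (hP : IsDecomposable P)
    (hir : G.Adj i r)
    (eq_zero : ∀ j k, ¬G.Adj j k → P j k = 0) (isUnit : ∀ j k, G.Adj j k → IsUnit (P j k))
    (hm_right : ∀ j, G.Adj j r → m j * P i r = P j r)
    (hm_left : ∀ j, ¬G.Adj j r → G.Adj i j → m j * P i r = P i j)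
    (hs : ∀ j, G.Adj i j → G.Adj j r → s (G.neighborSet j) * P j r = P i j) :
    P i r • lineCoords G i r m s = P := by
  have first (j) : P i r * firstCoord G r m j = P j r := by
    rw [firstCoord]
    split_ifs with h
    · rw [mul_comm, hm_right j h]
    · rw [mul_zero, eq_zero j r h]
  have second (j) : P i r * secondCoord G i r m s j = P i j := by
    rw [secondCoord]
    split_ifs with h h'
    · rw [mul_left_comm, ← mul_assoc, hm_right j h', mul_comm, hs j h h']
    · rw [mul_one, mul_comm, hm_left j h' h]
    · rw [mul_zero, eq_zero i j h]
  refine (isUnit i r hir).smul_left_cancel.mp ?_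
  rw [hP.smul_eq_wedge]
  ext j k
  simp only [lineCoords, wedge, Matrix.smul_apply, smul_eq_mul]
  linear_combination P i r * secondCoord G i r m s k * first j + P j r * second k -
    P i r * secondCoord G i r m s j * first k - P k r * second j +
    P i k * hP.isAlternating.swap j r - P i j * hP.isAlternating.swap k r

end LineChart

section Matroids

open Matroid

variable {α : Type*} {M N : Matroid α} {i j k r : α}

/-- `M` is a quotient of `N`, two matroids on the same ground set. -/
structure IsQuotientOf (M N : Matroid α) : Prop where
  ground_eq : M.E = N.E
  closure_subset : ∀ X, N.closure X ⊆ M.closure X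

theorem isQuotientOf_of_isFlat (hE : M.E = N.E) (h : ∀ F, M.IsFlat F → N.IsFlat F) :
    IsQuotientOf M N where
  ground_eq := hE
  closure_subset X := calc
    N.closure X = N.closure (X ∩ M.E) := by rw [hE, closure_inter_ground]
    _ ⊆ N.closure (M.closure X) := N.closure_subset_closure (M.inter_ground_subset_closure X)
    _ = M.closure X := (h _ (M.isFlat_closure X)).closure

theorem mem_dual_closure_iff {X : Set α} {e : α} (he : e ∈ M.E) (heX : e ∉ X) :
    e ∈ M✶.closure X ↔ e ∉ M.closure ((M.E \ X) \ {e}) := by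
  have loop_iff : (M✶ ／ X).IsLoop e ↔ (M ＼ X).IsColoop e := by
    rw [← dual_delete, dual_isLoop_iff_isColoop]
  simpa only [contract_isLoop_iff_mem_closure, delete_isColoop_iff, heX, he, not_false_iff,
    and_true] using loop_iff

theorem IsQuotientOf.dual (h : IsQuotientOf M N) : IsQuotientOf N✶ M✶ where
  ground_eq := h.ground_eq.symm
  closure_subset X e he := by
    have e_mem : e ∈ M.E := M✶.mem_ground_of_mem_closure he
    by_cases heX : e ∈ X
    · exact N✶.mem_closure_of_mem' heX (h.ground_eq ▸ e_mem : e ∈ N.E)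
    · rw [mem_dual_closure_iff e_mem heX] at he
      rw [mem_dual_closure_iff (h.ground_eq ▸ e_mem) heX, ← h.ground_eq]
      exact fun he' => he (h.closure_subset _ he')

/-- The graph on the ground set of `N` whose edges are the bases of `N` with two elements. -/
def basePairGraph (N : Matroid α) : SimpleGraph α where
  Adj j k := j ≠ k ∧ N.IsBase {j, k}
  symm := ⟨fun j k h => ⟨h.1.symm, Set.pair_comm j k ▸ h.2⟩⟩
  loopless := ⟨fun _ h => h.1 rfl⟩

theorem hasExchange_basePairGraph (N : Matroid α) : HasExchange (basePairGraph N) := by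
  intro i j k l hij hkl
  by_cases hj : j ∈ ({k, l} : Set α)
  · rcases hj with rfl | rfl
    exacts [Or.inl hij, Or.inr hij]
  · obtain ⟨y, ⟨hy, hyi⟩, isBase⟩ := hij.2.exchange_mem hkl.2 (Set.mem_insert_of_mem i rfl) hj
    rw [Set.pair_sdiff_right hij.1, Set.pair_comm] at isBase
    have adj_y : (basePairGraph N).Adj i y := ⟨fun e => hyi (e ▸ Set.mem_insert i _), isBase⟩
    rcases hy with rfl | rfl
    exacts [Or.inl adj_y, Or.inr adj_y]

theorem isBase_pair_of_indep (hN : N.eRank = 2) (hjk : j ≠ k) (h : N.Indep {j, k}) :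
    N.IsBase {j, k} :=
  h.isBase_of_eRk_ge (Set.toFinite _) (by rw [hN, h.eRk_eq_encard, Set.encard_pair hjk])

theorem basePairGraph_adj_of_notMem_closure (hN : N.eRank = 2) (hr : N.IsNonloop r)
    (hj : j ∈ N.E) (h : j ∉ N.closure {r}) : (basePairGraph N).Adj j r := by
  have hjr : j ≠ r := by
    rintro rfl
    exact h (N.mem_closure_self j)
  exact ⟨hjr, isBase_pair_of_indep hN hjr
    ((hr.indep.notMem_closure_iff_of_notMem (by simpa using hjr)).mp h)⟩

theorem exists_basePairGraph_adj (hN : N.eRank = 2) (hj : N.IsNonloop j) :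
    ∃ k, (basePairGraph N).Adj j k := by
  obtain ⟨B, hB, hjB⟩ := hj.exists_mem_isBase
  obtain ⟨x, y, hxy, rfl⟩ := Set.encard_eq_two.mp (hB.encard_eq_eRank.trans hN)
  rcases hjB with rfl | rfl
  exacts [⟨y, hxy, hB⟩, ⟨x, hxy.symm, Set.pair_comm x j ▸ hB⟩]

theorem IsQuotientOf.isNonloop (h : IsQuotientOf M N) (hj : M.IsNonloop j) : N.IsNonloop j := by
  rw [isNonloop_iff_mem_compl_loops] at hj ⊢
  exact ⟨h.ground_eq ▸ hj.1, fun hj' => hj.2 (h.closure_subset ∅ hj')⟩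

theorem IsQuotientOf.basePairGraph_adj (h : IsQuotientOf M N) (hN : N.eRank = 2)
    (hj : M.IsNonloop j) (hr : N.IsNonloop r) (hr' : ¬M.IsNonloop r) :
    (basePairGraph N).Adj j r :=
  basePairGraph_adj_of_notMem_closure hN hr (h.ground_eq ▸ hj.mem_ground) fun hjr =>
    hr' (hj.isNonloop_of_mem_closure (h.closure_subset _ hjr))

theorem IsQuotientOf.isNonloop_or_isNonloop [M.RankPos] (h : IsQuotientOf M N)
    (hjk : (basePairGraph N).Adj j k) : M.IsNonloop j ∨ M.IsNonloop k := by
  obtain ⟨i, hi⟩ := M.exists_isNonloop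
  by_contra! loops
  have pair_subset : ({j, k} : Set α) ⊆ M.loops := by
    have mem_ground {x : α} (hx : x ∈ ({j, k} : Set α)) : x ∈ M.E :=
      h.ground_eq ▸ hjk.2.subset_ground hx
    rintro x (rfl | rfl)
    · exact (not_isNonloop_iff (mem_ground (Set.mem_insert _ _))).mp loops.1
    · exact (not_isNonloop_iff (mem_ground (Set.mem_insert_of_mem _ rfl))).mp loops.2
  have mem_closure : i ∈ M.closure {j, k} :=
    h.closure_subset _ (hjk.2.closure_eq ▸ h.ground_eq ▸ hi.mem_ground)
  rw [closure_eq_loops_of_subset pair_subset] at mem_closure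
  exact (isNonloop_iff_mem_compl_loops.mp hi).2 mem_closure

/-- Two elements of a matroid `N` of rank 2 which serve as a frame for the points of a line, chosen
in such a way that the nonloops of a quotient `M` of `N` of rank 1 are the support of the points
`c • P fst - P snd` of a line `P` with matroid `N`, where `c` is zero or generic according to
whether `snd` is a loop of `M`. -/
structure Frame (M N : Matroid α) where
  (fst snd : α)
  isNonloop_fst : M.IsNonloop fst
  adj : (basePairGraph N).Adj fst snd
  isNonloop_iff : ∀ j, M.IsNonloop j ↔
    (basePairGraph N).Adj j snd ∨ (M.IsNonloop snd ∧ (basePairGraph N).Adj fst j)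

theorem IsQuotientOf.nonempty_frame [M.RankPos] (h : IsQuotientOf M N) (hN : N.eRank = 2) :
    Nonempty (Frame M N) := by
  obtain ⟨i, hi⟩ := M.exists_isNonloop
  by_cases all_isNonloop : ∀ r, N.IsNonloop r → M.IsNonloop r
  · obtain ⟨r, hir⟩ := exists_basePairGraph_adj hN (h.isNonloop hi)
    have isNonloop {j k} (hjk : (basePairGraph N).Adj j k) : M.IsNonloop j :=
      all_isNonloop j (hjk.2.indep.isNonloop_of_mem (Set.mem_insert j _))
    refine ⟨⟨i, r, hi, hir, fun j => ⟨fun hj => ?_, ?_⟩⟩⟩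
    · obtain ⟨k, hjk⟩ := exists_basePairGraph_adj hN (h.isNonloop hj)
      exact ((hasExchange_basePairGraph N hjk hir).symm).imp_right fun hji =>
        ⟨isNonloop hir.symm, hji.symm⟩
    · rintro (hjr | ⟨-, hij⟩)
      exacts [isNonloop hjr, isNonloop hij.symm]
  · push Not at all_isNonloop
    obtain ⟨r, hr, hr'⟩ := all_isNonloop
    refine ⟨⟨i, r, hi, h.basePairGraph_adj hN hi hr hr', fun j => ⟨fun hj =>
      Or.inl (h.basePairGraph_adj hN hj hr hr'), ?_⟩⟩⟩
    rintro (hjr | ⟨hr'', -⟩)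
    exacts [(h.isNonloop_or_isNonloop hjr).resolve_right hr', absurd hr'' hr']

end Matroids

section FlagMatroids

open Matroid

variable {Q : Fin 3 → Matroid (Fin 4)} {j k : Fin 4}

theorem rankPos_of_eRank_eq_one {α : Type*} {M : Matroid α} (h : M.eRank = 1) : M.RankPos :=
  M.eq_loopyOn_or_rankPos.resolve_left fun h' => by
    rw [h', eRank_loopyOn] at h
    exact zero_ne_one h

theorem isBase_singleton_iff {α : Type*} {M : Matroid α} (h : M.eRank = 1) {e : α} :
    M.IsBase {e} ↔ M.IsNonloop e :=
  ⟨fun he => indep_singleton.mp he.indep, fun he => he.indep.isBase_of_eRk_ge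
    (Set.finite_singleton e) (by rw [h, he.indep.eRk_eq_encard, Set.encard_singleton])⟩

theorem IsFlagMatroid.isQuotientOf {α : Type} {s : ℕ} {E : Set α} {r : Fin s → ℕ}
    {Q : Fin s → Matroid α} (hQ : IsFlagMatroid E r Q) {i j : Fin s} (h : i ≤ j) :
    IsQuotientOf (Q i) (Q j) :=
  isQuotientOf_of_isFlat ((hQ.ground_eq i).trans (hQ.ground_eq j).symm) (hQ.isFlat_of_le i j h)

theorem eRank_dual_eq {α : Type*} {N : Matroid α} {m n : ℕ} (hN : N.eRank = m)
    (hE : N.E.encard = m + n) : N✶.eRank = n := by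
  have add_eq := N.eRank_add_eRank_dual.trans hE
  rw [hN] at add_eq
  exact ENat.add_right_injective_of_ne_top (ENat.natCast_ne_top m) add_eq

theorem IsFlagMatroid.eRank_dual_line (hQ : IsFlagMatroid Set.univ ![1, 2, 3] Q) :
    (Q 1)✶.eRank = 2 :=
  eRank_dual_eq (m := 2) (n := 2) (hQ.eRank_eq 1) (by
    rw [hQ.ground_eq, Set.encard_univ, ENat.card_eq_coe_fintype_card]
    rfl)

theorem IsFlagMatroid.eRank_dual_plane (hQ : IsFlagMatroid Set.univ ![1, 2, 3] Q) :
    (Q 2)✶.eRank = 1 := by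
  rw [← Nat.cast_one]
  refine eRank_dual_eq (m := 3) (hQ.eRank_eq 2) ?_
  rw [hQ.ground_eq, Set.encard_univ, ENat.card_eq_coe_fintype_card]
  rfl

theorem IsFlagMatroid.nonempty_frame_point (hQ : IsFlagMatroid Set.univ ![1, 2, 3] Q) :
    Nonempty (Frame (Q 0) (Q 1)) := by
  have := rankPos_of_eRank_eq_one (hQ.eRank_eq 0)
  exact (hQ.isQuotientOf (by decide)).nonempty_frame (hQ.eRank_eq 1)

theorem IsFlagMatroid.nonempty_frame_plane (hQ : IsFlagMatroid Set.univ ![1, 2, 3] Q) :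
    Nonempty (Frame (Q 2)✶ (Q 1)✶) := by
  have := rankPos_of_eRank_eq_one hQ.eRank_dual_plane
  exact (hQ.isQuotientOf (by decide)).dual.nonempty_frame hQ.eRank_dual_line

theorem IsFlagMatroid.exists_isBaseIndex {α : Type} {s : ℕ} {E : Set α} {r : Fin s → ℕ}
    {Q : Fin s → Matroid α} (hQ : IsFlagMatroid E r Q) (i : Fin s) :
    ∃ l : {l : Finset E // l.card = r i}, IsBaseIndex Q ⟨i, l⟩ := by
  obtain ⟨B, hB⟩ := (Q i).exists_isBase
  obtain ⟨l, hl⟩ : ∃ l : Finset E, Subtype.val '' (l : Set E) = B := by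
    have finite_B : B.Finite :=
      Set.finite_of_encard_eq_coe (hB.encard_eq_eRank.trans (hQ.eRank_eq i))
    have B_subset : B ⊆ E := hQ.ground_eq i ▸ hB.subset_ground
    refine ⟨(finite_B.preimage Subtype.val_injective.injOn).toFinset, ?_⟩
    rw [Set.Finite.coe_toFinset, Subtype.image_preimage_coe, Set.inter_eq_right.mpr B_subset]
  have card_l : (l.card : ℕ∞) = r i := by
    rw [← Set.encard_coe_eq_coe_finsetCard, ← Subtype.val_injective.encard_image, hl,
      hB.encard_eq_eRank, hQ.eRank_eq]
  exact ⟨⟨l, Nat.cast_injective card_l⟩, by rwa [IsBaseIndex, hl]⟩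

theorem isBaseIndex_pointIndex (hQ : (Q 0).eRank = 1) :
    IsBaseIndex Q (pointIndex j) ↔ (Q 0).IsNonloop j := by
  rw [← isBase_singleton_iff hQ]
  simp [IsBaseIndex, pointIndex]

theorem isBaseIndex_lineIndex (h : j ≠ k) :
    IsBaseIndex Q (lineIndex j k h) ↔ (basePairGraph (Q 1)).Adj j k := by
  simp [IsBaseIndex, lineIndex, Set.image_pair, basePairGraph, h]

theorem isBaseIndex_planeIndex (hQ : (Q 2)✶.eRank = 1) (hE : (Q 2).E = Set.univ) :
    IsBaseIndex Q (planeIndex j) ↔ (Q 2)✶.IsNonloop j := by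
  have image_eq : Subtype.val '' ((planeIndex j).2.1 : Set (Set.univ : Set (Fin 4))) =
      (Q 2).E \ {j} := by
    ext x
    simp [planeIndex, hE]
  rw [← isBase_singleton_iff hQ, dual_isBase_iff (hE ▸ Set.subset_univ _), ← image_eq]
  rfl

theorem basePairGraph_dual_adj {N : Matroid (Fin 4)} (hE : N.E = Set.univ) :
    (basePairGraph N✶).Adj j k ↔ (basePairGraph N).Adj (hodge j k).1 (hodge j k).2 := by
  have ne_iff : j ≠ k ↔ (hodge j k).1 ≠ (hodge j k).2 := by decide +revert
  have compl_eq (hjk : j ≠ k) : N.E \ {j, k} = {(hodge j k).1, (hodge j k).2} := by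
    rw [hE]
    ext x
    revert hjk
    simp only [Set.mem_sdiff, Set.mem_univ, true_and, Set.mem_insert_iff, Set.mem_singleton_iff]
    decide +revert
  refine (and_congr_right fun hjk => ?_).trans (and_congr_left' ne_iff)
  rw [dual_isBase_iff (hE ▸ Set.subset_univ _), compl_eq hjk]

end FlagMatroids

section LinePoint

variable {ι A : Type*} [CommRing A] {P : Matrix ι ι A} {a : ι → A} {i r : ι} {c : A}

/-- The point of the line `P` whose coordinates at `i` and `r` are in the ratio `1 : c`. -/
def linePoint (P : Matrix ι ι A) (i r : ι) (c : A) : ι → A := c • P i - P r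

theorem comp_linePoint {B : Type*} [CommRing B] (φ : A →+* B) :
    φ ∘ linePoint P i r c = linePoint (P.map φ) i r (φ c) :=
  funext fun j => by simp [linePoint]

theorem linePoint_smul (u : A) : linePoint (u • P) i r c = u • linePoint P i r c := by
  simp only [linePoint, smul_sub]
  exact congrArg (· - u • P r) (smul_comm c u (P i))

theorem IsAlternating.linePoint_fst (hP : IsAlternating P) : linePoint P i r c i = P i r := by
  simp [linePoint, hP.self, hP.swap i r]

theorem IsAlternating.linePoint_snd (hP : IsAlternating P) : linePoint P i r c r = c * P i r := by
  simp [linePoint, hP.self]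

theorem linePoint_ne_zero_iff [IsDomain A] (hP : IsAlternating P) (φ : A →+* A)
    (hφP : P.map φ = P) (hφc : φ c = 0) (j : ι) :
    linePoint P i r c j ≠ 0 ↔ P j r ≠ 0 ∨ c ≠ 0 ∧ P i j ≠ 0 := by
  have map_eq : φ (linePoint P i r c j) = P j r := by
    rw [← Function.comp_apply (f := φ), comp_linePoint, hφP, hφc]
    simp [linePoint, hP.swap j r]
  by_cases hjr : P j r = 0
  · simp [linePoint, hP.swap j r, hjr]
  · refine iff_of_true (fun h => hjr ?_) (Or.inl hjr)
    rw [← map_eq, h, map_zero]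

theorem Incident.smul_eq_smul_linePoint (h : Incident a P) (hP : IsAlternating P)
    (hc : c * a i = a r) : P i r • a = a i • linePoint P i r c := by
  rw [h.smul_eq hP, linePoint, smul_sub, smul_smul, ← hc, mul_comm]

theorem Incident.exists_isUnit_linePoint_eq {L : Matrix ι ι A} {u : A} (h : Incident a P)
    (hP : IsAlternating P) (hc : c * a i = a r) (ha : IsUnit (a i)) (hir : IsUnit (P i r))
    (hu : IsUnit u) (hL : u • L = P) : ∃ d : A, IsUnit d ∧ linePoint L i r c = d • a := by
  obtain ⟨w, hw⟩ := ha.mul hu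
  refine ⟨(w⁻¹ : Aˣ) * P i r, w⁻¹.isUnit.mul hir, ?_⟩
  rw [mul_smul, h.smul_eq_smul_linePoint hP hc, ← hL, linePoint_smul, smul_smul, smul_smul,
    mul_assoc, ← hw, Units.inv_mul, one_smul]

end LinePoint

section InvertibleBases

open Matroid

variable {A : Type*} [CommRing A] {Q : Fin 3 → Matroid (Fin 4)} {π : FlagIndex → A} {j k : Fin 4}

theorem exists_lineCoord_eq_smul (h : j ≠ k) : ∃ e : ℤˣ, ∀ {A : Type*} [CommRing A]
    (π : FlagIndex → A), lineCoord π j k = e • π (lineIndex j k h) := by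
  rcases lt_or_gt_of_ne h with hjk | hkj
  · exact ⟨1, fun π => by rw [lineCoord_of_lt π hjk, one_smul]⟩
  · exact ⟨-1, fun π => by
      rw [lineCoord_swap, lineCoord_of_lt π hkj, lineIndex_comm, Units.neg_smul, one_smul]⟩

theorem planeCoord_eq_smul (π : FlagIndex → A) (j : Fin 4) :
    planeCoord π j = ((-1) ^ (j : ℕ) : ℤˣ) • π (planeIndex j) := by
  simp [planeCoord, Units.smul_def]

/-- The coordinates `π` are those of a family of flags all of which have flag matroid `Q`. -/
structure HasInvertibleBases (Q : Fin 3 → Matroid (Fin 4)) (π : FlagIndex → A) : Prop where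
  isUnit : ∀ x, IsBaseIndex Q x → IsUnit (π x)
  eq_zero : ∀ x, ¬IsBaseIndex Q x → π x = 0

namespace HasInvertibleBases

variable (hπ : HasInvertibleBases Q π)

include hπ

theorem isUnit_pointCoord (hQ : (Q 0).eRank = 1) (hj : (Q 0).IsNonloop j) :
    IsUnit (pointCoord π j) :=
  hπ.isUnit _ ((isBaseIndex_pointIndex hQ).mpr hj)

theorem pointCoord_eq_zero (hQ : (Q 0).eRank = 1) (hj : ¬(Q 0).IsNonloop j) :
    pointCoord π j = 0 :=
  hπ.eq_zero _ (mt (isBaseIndex_pointIndex hQ).mp hj)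

theorem isUnit_lineCoord (h : (basePairGraph (Q 1)).Adj j k) : IsUnit (lineCoord π j k) := by
  obtain ⟨e, he⟩ := exists_lineCoord_eq_smul h.ne
  rw [he, isUnit_smul_iff]
  exact hπ.isUnit _ ((isBaseIndex_lineIndex h.ne).mpr h)

theorem lineCoord_eq_zero (h : ¬(basePairGraph (Q 1)).Adj j k) : lineCoord π j k = 0 := by
  rcases eq_or_ne j k with rfl | hjk
  · exact lineCoord_self π j
  · obtain ⟨e, he⟩ := exists_lineCoord_eq_smul hjk
    rw [he, hπ.eq_zero _ (mt (isBaseIndex_lineIndex hjk).mp h), smul_zero]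

theorem isUnit_planeCoord (hQ : (Q 2)✶.eRank = 1) (hE : (Q 2).E = Set.univ)
    (hj : (Q 2)✶.IsNonloop j) : IsUnit (planeCoord π j) := by
  rw [planeCoord_eq_smul, isUnit_smul_iff]
  exact hπ.isUnit _ ((isBaseIndex_planeIndex hQ hE).mpr hj)

theorem planeCoord_eq_zero (hQ : (Q 2)✶.eRank = 1) (hE : (Q 2).E = Set.univ)
    (hj : ¬(Q 2)✶.IsNonloop j) : planeCoord π j = 0 := by
  rw [planeCoord_eq_smul, hπ.eq_zero _ (mt (isBaseIndex_planeIndex hQ hE).mp hj), smul_zero]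

end HasInvertibleBases

end InvertibleBases

section FlagParameters

open Matroid

namespace Frame

variable {α : Type*} {M N : Matroid α} (F : Frame M N)

/-- The vectors of `N` which are parallel to neither vector of a frame. -/
def IsGeneric (j : α) : Prop := (basePairGraph N).Adj F.fst j ∧ (basePairGraph N).Adj j F.snd

/-- A representative of the parallel class of generic vectors with neighbour set `C`; junk if there
is no such class. -/
noncomputable def classRep (C : Set α) : α :=
  @Classical.epsilon α ⟨F.fst⟩ fun j => F.IsGeneric j ∧ (basePairGraph N).neighborSet j = C

variable {F}

theorem classRep_spec {C : Set α}
    (h : ∃ j, F.IsGeneric j ∧ (basePairGraph N).neighborSet j = C) :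
    F.IsGeneric (F.classRep C) ∧ (basePairGraph N).neighborSet (F.classRep C) = C :=
  @Classical.epsilon_spec α _ h

end Frame

/-- The parameters of a flag with given flag matroid: those of its line in a frame `i, r`, that is,
a scale for every vector and a slope for every parallel class, and the parameters of its point and
plane in the pencils given by the line. -/
inductive FlagParam
  | scale (j : Fin 4)
  | slope (C : Set (Fin 4))
  | point
  | plane

instance : Finite FlagParam :=
  Finite.of_surjective
    (Sum.elim FlagParam.scale (Sum.elim FlagParam.slope fun b : Bool => cond b .point .plane)) fun
    | .scale j => ⟨.inl j, rfl⟩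
    | .slope C => ⟨.inr (.inl C), rfl⟩
    | .point => ⟨.inr (.inr true), rfl⟩
    | .plane => ⟨.inr (.inr false), rfl⟩

variable {Q : Fin 3 → Matroid (Fin 4)} (F : Frame (Q 0) (Q 1)) (F' : Frame (Q 2)✶ (Q 1)✶)

/-- The parameters which are not constant on the stratum of `Q`. -/
def IsFreeParam : FlagParam → Prop
  | .scale j => ((basePairGraph (Q 1)).Adj F.fst j ∨ (basePairGraph (Q 1)).Adj j F.snd) ∧
      j ≠ F.fst ∧ j ≠ F.snd
  | .slope C => ∃ j, F.IsGeneric j ∧ (basePairGraph (Q 1)).neighborSet j = C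
  | .point => (Q 0).IsNonloop F.snd
  | .plane => (Q 2)✶.IsNonloop F'.snd

/-- The values of the parameters which are not free. -/
def FlagParam.default {A : Type*} [CommRing A] : FlagParam → A
  | .scale _ | .slope _ => 1
  | .point | .plane => 0

section Values

variable {A B : Type*} [CommRing A] [CommRing B]

open Classical in
/-- Values of all parameters from values of the free ones. -/
noncomputable def extendParam (g : {v // IsFreeParam F F' v} → A) (v : FlagParam) : A :=
  if h : IsFreeParam F F' v then g ⟨v, h⟩ else v.default

/-- The line of the flag with parameters `f`. -/
noncomputable def paramLine (f : FlagParam → A) : Matrix (Fin 4) (Fin 4) A :=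
  lineCoords (basePairGraph (Q 1)) F.fst F.snd (f ∘ .scale) (f ∘ .slope)

/-- The coordinates of the flag with parameters `f`. -/
noncomputable def paramCoords (f : FlagParam → A) : FlagIndex → A :=
  flagCoords (linePoint (paramLine F f) F.fst F.snd (f .point)) (paramLine F f)
    (linePoint (hodgeStar (paramLine F f)) F'.fst F'.snd (f .plane))

open Classical in
/-- The numerator of a parameter as a ratio of coordinates. -/
noncomputable def paramNum (π : FlagIndex → A) : FlagParam → A
  | .scale j => if (basePairGraph (Q 1)).Adj j F.snd then lineCoord π j F.snd
      else lineCoord π F.fst j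
  | .slope C => lineCoord π F.fst (F.classRep C)
  | .point => pointCoord π F.snd
  | .plane => planeCoord π F'.snd

/-- The denominator of a parameter as a ratio of coordinates. -/
noncomputable def paramDen (π : FlagIndex → A) : FlagParam → A
  | .scale _ => lineCoord π F.fst F.snd
  | .slope C => lineCoord π (F.classRep C) F.snd
  | .point => pointCoord π F.fst
  | .plane => planeCoord π F'.fst

variable {F F'}

variable {f : FlagParam → A} {g : {v // IsFreeParam F F' v} → A}

theorem extendParam_of_isFreeParam {v : FlagParam} (h : IsFreeParam F F' v) :
    extendParam F F' g v = g ⟨v, h⟩ := dif_pos h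

theorem extendParam_of_not_isFreeParam {v : FlagParam} (h : ¬IsFreeParam F F' v) :
    extendParam F F' g v = v.default := dif_neg h

theorem map_default (φ : A →+* B) (v : FlagParam) : φ v.default = v.default := by
  cases v
  exacts [map_one φ, map_one φ, map_zero φ, map_zero φ]

theorem comp_extendParam (φ : A →+* B) :
    φ ∘ extendParam F F' g = extendParam F F' (φ ∘ g) := by
  ext v
  by_cases h : IsFreeParam F F' v
  · simp only [Function.comp_apply, extendParam_of_isFreeParam h]
  · simp only [Function.comp_apply, extendParam_of_not_isFreeParam h, map_default]

theorem map_paramLine (φ : A →+* B) : (paramLine F f).map φ = paramLine F (φ ∘ f) :=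
  map_lineCoords φ

theorem comp_paramCoords (φ : A →+* B) :
    φ ∘ paramCoords F F' f = paramCoords F F' (φ ∘ f) := by
  simp only [paramCoords, comp_flagCoords, comp_linePoint, map_hodgeStar, map_paramLine,
    Function.comp_apply]

theorem isDecomposable_paramLine : IsDecomposable (paramLine F f) := isDecomposable_wedge _ _

theorem pointCoord_paramCoords : pointCoord (paramCoords F F' f) =
    linePoint (paramLine F f) F.fst F.snd (f .point) := pointCoord_flagCoords _ _ _

theorem lineCoord_paramCoords : lineCoord (paramCoords F F' f) = paramLine F f :=
  lineCoord_flagCoords _ isDecomposable_paramLine.isAlternating _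

theorem planeCoord_paramCoords : planeCoord (paramCoords F F' f) =
    linePoint (hodgeStar (paramLine F f)) F'.fst F'.snd (f .plane) := planeCoord_flagCoords _ _ _

theorem satisfiesPluckerRelations_paramCoords :
    SatisfiesPluckerRelations (paramCoords F F' f) := by
  rw [SatisfiesPluckerRelations, pointCoord_paramCoords, lineCoord_paramCoords,
    planeCoord_paramCoords]
  exact ⟨isDecomposable_paramLine, isDecomposable_paramLine.incident_smul_row_sub_row _ _ _,
    isDecomposable_paramLine.hodgeStar.incident_smul_row_sub_row _ _ _⟩

theorem extendParam_scale_fst : extendParam F F' g (.scale F.fst) = 1 :=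
  extendParam_of_not_isFreeParam fun h => h.2.1 rfl

theorem extendParam_scale_snd : extendParam F F' g (.scale F.snd) = 1 :=
  extendParam_of_not_isFreeParam fun h => h.2.2 rfl

theorem paramLine_fst_snd (snd : f (.scale F.snd) = 1) :
    paramLine F f F.fst F.snd = f (.scale F.fst) := by
  rw [paramLine, lineCoords_right F.adj snd, firstCoord, if_pos F.adj]
  rfl

theorem mul_paramDen_paramCoords (fst : f (.scale F.fst) = 1) (snd : f (.scale F.snd) = 1)
    {v : FlagParam} (hv : IsFreeParam F F' v) :
    f v * paramDen F F' (paramCoords F F' f) v = paramNum F F' (paramCoords F F' f) v := by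
  cases v with
  | scale j =>
    obtain ⟨hj, -, -⟩ := hv
    simp only [paramNum, paramDen, lineCoord_paramCoords, paramLine_fst_snd snd, fst, mul_one]
    split_ifs with hjr
    · rw [paramLine, lineCoords_right F.adj snd, firstCoord, if_pos hjr]
      rfl
    · rw [paramLine, lineCoords_left F.adj fst, secondCoord, if_pos (hj.resolve_right hjr),
        if_neg hjr, mul_one]
      rfl
  | slope C =>
    obtain ⟨⟨hij, hjr⟩, neighborSet_eq⟩ := Frame.classRep_spec hv
    simp only [paramNum, paramDen, lineCoord_paramCoords]
    rw [paramLine, lineCoords_left F.adj fst, lineCoords_right F.adj snd, secondCoord, firstCoord,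
      if_pos hij, if_pos hjr, if_pos hjr, neighborSet_eq]
    exact mul_comm _ _
  | point =>
    simp only [paramNum, paramDen, pointCoord_paramCoords]
    rw [isDecomposable_paramLine.isAlternating.linePoint_fst,
      isDecomposable_paramLine.isAlternating.linePoint_snd]
  | plane =>
    simp only [paramNum, paramDen, planeCoord_paramCoords]
    rw [isDecomposable_paramLine.hodgeStar.isAlternating.linePoint_fst,
      isDecomposable_paramLine.hodgeStar.isAlternating.linePoint_snd]

end Values

end FlagParameters

section ParametersOfFamily

open Matroid

variable {A : Type*} [CommRing A] {Q : Fin 3 → Matroid (Fin 4)} {F : Frame (Q 0) (Q 1)}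
  {F' : Frame (Q 2)✶ (Q 1)✶} {g : {v // IsFreeParam F F' v} → A} {ρ : FlagIndex → A} {j : Fin 4}

theorem extendParam_scale_mul (hg : ∀ v, g v * paramDen F F' ρ v = paramNum F F' ρ v)
    (hj : (basePairGraph (Q 1)).Adj F.fst j ∨ (basePairGraph (Q 1)).Adj j F.snd) :
    extendParam F F' g (.scale j) * lineCoord ρ F.fst F.snd =
      paramNum F F' ρ (.scale j) := by
  by_cases fst : j = F.fst
  · rw [fst, extendParam_scale_fst, one_mul, paramNum, if_pos F.adj]
  by_cases snd : j = F.snd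
  · rw [snd, extendParam_scale_snd, one_mul, paramNum, if_neg (SimpleGraph.irrefl _)]
  have isFree : IsFreeParam F F' (.scale j) := ⟨hj, fst, snd⟩
  rw [extendParam_of_isFreeParam isFree]
  exact hg ⟨_, isFree⟩

theorem extendParam_slope_mul (hρ : SatisfiesPluckerRelations ρ) (hbases : HasInvertibleBases Q ρ)
    (hg : ∀ v, g v * paramDen F F' ρ v = paramNum F F' ρ v) (hj : F.IsGeneric j) :
    extendParam F F' g (.slope ((basePairGraph (Q 1)).neighborSet j)) * lineCoord ρ j F.snd =
      lineCoord ρ F.fst j := by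
  have isFree : IsFreeParam F F' (.slope ((basePairGraph (Q 1)).neighborSet j)) := ⟨j, hj, rfl⟩
  obtain ⟨⟨-, hk⟩, neighborSet_eq⟩ := Frame.classRep_spec isFree
  have ratio_eq := hg ⟨_, isFree⟩
  simp only [paramNum, paramDen] at ratio_eq
  set k := F.classRep ((basePairGraph (Q 1)).neighborSet j)
  have not_adj : ¬(basePairGraph (Q 1)).Adj j k := fun h =>
    (basePairGraph (Q 1)).irrefl (neighborSet_eq ▸ h : k ∈ (basePairGraph (Q 1)).neighborSet k)
  have plucker := hρ.isDecomposable.incident_row F.fst j k F.snd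
  rw [hbases.lineCoord_eq_zero not_adj] at plucker
  rw [extendParam_of_isFreeParam isFree]
  refine (hbases.isUnit_lineCoord hk).mul_left_cancel ?_
  linear_combination lineCoord ρ j F.snd * ratio_eq - plucker

theorem extendParam_point_mul (hQ : (Q 0).eRank = 1) (hbases : HasInvertibleBases Q ρ)
    (hg : ∀ v, g v * paramDen F F' ρ v = paramNum F F' ρ v) :
    extendParam F F' g .point * pointCoord ρ F.fst = pointCoord ρ F.snd := by
  by_cases h : IsFreeParam F F' .point
  · rw [extendParam_of_isFreeParam h]
    exact hg ⟨.point, h⟩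
  · rw [extendParam_of_not_isFreeParam h, hbases.pointCoord_eq_zero hQ h]
    exact zero_mul _

theorem extendParam_plane_mul (hQ : (Q 2)✶.eRank = 1) (hE : (Q 2).E = Set.univ)
    (hbases : HasInvertibleBases Q ρ)
    (hg : ∀ v, g v * paramDen F F' ρ v = paramNum F F' ρ v) :
    extendParam F F' g .plane * planeCoord ρ F'.fst = planeCoord ρ F'.snd := by
  by_cases h : IsFreeParam F F' .plane
  · rw [extendParam_of_isFreeParam h]
    exact hg ⟨.plane, h⟩
  · rw [extendParam_of_not_isFreeParam h, hbases.planeCoord_eq_zero hQ hE h]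
    exact zero_mul _

theorem smul_paramLine_eq (hρ : SatisfiesPluckerRelations ρ) (hbases : HasInvertibleBases Q ρ)
    (hg : ∀ v, g v * paramDen F F' ρ v = paramNum F F' ρ v) :
    lineCoord ρ F.fst F.snd • paramLine F (extendParam F F' g) = lineCoord ρ :=
  hρ.isDecomposable.smul_lineCoords_eq F.adj (fun _ _ => hbases.lineCoord_eq_zero)
    (fun _ _ => hbases.isUnit_lineCoord)
    (fun _ h => (extendParam_scale_mul hg (.inr h)).trans (if_pos h))
    (fun _ h h' => (extendParam_scale_mul hg (.inl h')).trans (if_neg h))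
    (fun _ h h' => extendParam_slope_mul hρ hbases hg ⟨h, h'⟩)

theorem exists_isUnit_paramCoords_eq (hQ : IsFlagMatroid Set.univ ![1, 2, 3] Q)
    (hρ : SatisfiesPluckerRelations ρ) (hbases : HasInvertibleBases Q ρ)
    (hg : ∀ v, g v * paramDen F F' ρ v = paramNum F F' ρ v) :
    ∃ d : Fin 3 → A, (∀ i, IsUnit (d i)) ∧
      paramCoords F F' (extendParam F F' g) = fun x => d x.1 * ρ x := by
  have hline := smul_paramLine_eq hρ hbases hg
  have isUnit_line := hbases.isUnit_lineCoord F.adj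
  obtain ⟨c, hc, point_eq⟩ := hρ.incident_point.exists_isUnit_linePoint_eq
    hρ.isDecomposable.isAlternating (extendParam_point_mul (hQ.eRank_eq 0) hbases hg)
    (hbases.isUnit_pointCoord (hQ.eRank_eq 0) F.isNonloop_fst) isUnit_line isUnit_line hline
  obtain ⟨d, hd, plane_eq⟩ := hρ.incident_plane.exists_isUnit_linePoint_eq
    (L := hodgeStar (paramLine F (extendParam F F' g)))
    hρ.isDecomposable.hodgeStar.isAlternating
    (extendParam_plane_mul hQ.eRank_dual_plane (hQ.ground_eq 2) hbases hg)
    (hbases.isUnit_planeCoord hQ.eRank_dual_plane (hQ.ground_eq 2) F'.isNonloop_fst)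
    (hbases.isUnit_lineCoord ((basePairGraph_dual_adj (hQ.ground_eq 1)).mp F'.adj))
    isUnit_line (congrArg hodgeStar hline)
  obtain ⟨u, hu⟩ := isUnit_line
  refine ⟨![c, (u⁻¹ : Aˣ), d], ?_, flagIndex_funext ?_ ?_ ?_⟩
  · exact Fin.forall_fin_succ.mpr ⟨hc, Fin.forall_fin_two.mpr ⟨u⁻¹.isUnit, hd⟩⟩
  · rw [pointCoord_smul, pointCoord_paramCoords, point_eq]
    rfl
  · rw [lineCoord_smul, lineCoord_paramCoords, ← hline, ← hu, smul_smul]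
    simp
  · rw [planeCoord_smul, planeCoord_paramCoords, plane_eq]
    rfl

end ParametersOfFamily

section GenericParameters

open Matroid

variable {Q : Fin 3 → Matroid (Fin 4)} (F : Frame (Q 0) (Q 1)) (F' : Frame (Q 2)✶ (Q 1)✶)

/-- The generic values of the parameters: independent variables for the free ones. -/
noncomputable def genericParam : FlagParam → MvPolynomial {v // IsFreeParam F F' v} ℂ :=
  extendParam F F' MvPolynomial.X

variable {F F'} {v : FlagParam} {j k : Fin 4}

theorem genericParam_coe (v : {v // IsFreeParam F F' v}) :
    genericParam F F' v = MvPolynomial.X v :=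
  extendParam_of_isFreeParam v.2

theorem aeval_comp_genericParam {A : Type*} [CommRing A] [Algebra ℂ A]
    (t : {v // IsFreeParam F F' v} → A) :
    MvPolynomial.aeval (R := ℂ) t ∘ genericParam F F' = extendParam F F' t :=
  (comp_extendParam (MvPolynomial.aeval (R := ℂ) t).toRingHom).trans
    (congrArg (extendParam F F') (funext (MvPolynomial.aeval_X t)))

theorem aeval_comp_paramCoords_genericParam {A : Type*} [CommRing A] [Algebra ℂ A]
    (t : {v // IsFreeParam F F' v} → A) :
    MvPolynomial.aeval (R := ℂ) t ∘ paramCoords F F' (genericParam F F') =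
      paramCoords F F' (extendParam F F' t) :=
  (comp_paramCoords (MvPolynomial.aeval (R := ℂ) t).toRingHom).trans
    (congrArg (paramCoords F F') (aeval_comp_genericParam t))

theorem genericParam_ne_zero (h : v.default ≠ (0 : MvPolynomial {v // IsFreeParam F F' v} ℂ)) :
    genericParam F F' v ≠ 0 := by
  by_cases hv : IsFreeParam F F' v
  · rw [genericParam, extendParam_of_isFreeParam hv]
    exact MvPolynomial.X_ne_zero _
  · rwa [genericParam, extendParam_of_not_isFreeParam hv]

theorem genericParam_ne_zero_iff (h : v.default = (0 : MvPolynomial {v // IsFreeParam F F' v} ℂ)) :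
    genericParam F F' v ≠ 0 ↔ IsFreeParam F F' v := by
  by_cases hv : IsFreeParam F F' v
  · rw [genericParam, extendParam_of_isFreeParam hv]
    exact iff_of_true (MvPolynomial.X_ne_zero _) hv
  · rw [genericParam, extendParam_of_not_isFreeParam hv, h]
    exact iff_of_false (not_not.mpr rfl) hv

theorem eq_of_genericParam_eq {w : FlagParam} (hv : IsFreeParam F F' v) (hw : IsFreeParam F F' w)
    (h : genericParam F F' v = genericParam F F' w) : v = w := by
  rw [genericParam, extendParam_of_isFreeParam hv, extendParam_of_isFreeParam hw] at h
  exact congrArg Subtype.val (MvPolynomial.X_injective h)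

theorem paramLine_genericParam_ne_zero_iff :
    paramLine F (genericParam F F') j k ≠ 0 ↔ (basePairGraph (Q 1)).Adj j k := by
  refine lineCoords_ne_zero_iff (hasExchange_basePairGraph _) F.adj
    (fun j => genericParam_ne_zero one_ne_zero)
    (fun C => genericParam_ne_zero one_ne_zero)
    (fun j k hij hjr hik hkr h => ?_) j k
  exact FlagParam.slope.inj (eq_of_genericParam_eq ⟨j, ⟨hij, hjr⟩, rfl⟩ ⟨k, ⟨hik, hkr⟩, rfl⟩ h)

theorem exists_ringHom_genericParam_eq_zero (F : Frame (Q 0) (Q 1)) (F' : Frame (Q 2)✶ (Q 1)✶)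
    (hv : v.default = (0 : MvPolynomial {v // IsFreeParam F F' v} ℂ)) :
    ∃ φ : MvPolynomial {v // IsFreeParam F F' v} ℂ →+* MvPolynomial {v // IsFreeParam F F' v} ℂ,
      φ (genericParam F F' v) = 0 ∧
        (paramLine F (genericParam F F')).map φ = paramLine F (genericParam F F') := by
  classical
  let g (w : {w // IsFreeParam F F' w}) : MvPolynomial {v // IsFreeParam F F' v} ℂ :=
    if w.1 = v then 0 else MvPolynomial.X w
  let φ := (MvPolynomial.aeval (R := ℂ) g).toRingHom
  have comp_genericParam : φ ∘ genericParam F F' = extendParam F F' g := aeval_comp_genericParam g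
  have map_eq (w : FlagParam) (hw : w ≠ v) : φ (genericParam F F' w) = genericParam F F' w :=
    (congrFun comp_genericParam w).trans (dite_congr rfl (fun _ => if_neg hw) fun _ => rfl)
  refine ⟨φ, (congrFun comp_genericParam v).trans ?_, (map_paramLine φ).trans ?_⟩
  · by_cases h : IsFreeParam F F' v
    · rw [extendParam_of_isFreeParam h]
      exact if_pos rfl
    · rw [extendParam_of_not_isFreeParam h, hv]
  · have ne_of_default_eq_one {w : FlagParam}
        (hw : w.default = (1 : MvPolynomial {v // IsFreeParam F F' v} ℂ)) : w ≠ v := by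
      rintro rfl
      exact one_ne_zero (hw.symm.trans hv)
    exact congrArg₂ (lineCoords _ _ _) (funext fun j => map_eq _ (ne_of_default_eq_one rfl))
      (funext fun C => map_eq _ (ne_of_default_eq_one rfl))

theorem pointCoord_paramCoords_genericParam_ne_zero_iff :
    pointCoord (paramCoords F F' (genericParam F F')) j ≠ 0 ↔ (Q 0).IsNonloop j := by
  obtain ⟨φ, map_point, map_line⟩ :=
    exists_ringHom_genericParam_eq_zero (v := .point) F F' rfl
  rw [pointCoord_paramCoords,
    linePoint_ne_zero_iff isDecomposable_paramLine.isAlternating φ map_line map_point,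
    paramLine_genericParam_ne_zero_iff, paramLine_genericParam_ne_zero_iff, F.isNonloop_iff,
    genericParam_ne_zero_iff rfl]
  rfl

theorem planeCoord_paramCoords_genericParam_ne_zero_iff (hE : (Q 1).E = Set.univ) :
    planeCoord (paramCoords F F' (genericParam F F')) j ≠ 0 ↔ (Q 2)✶.IsNonloop j := by
  obtain ⟨φ, map_plane, map_line⟩ :=
    exists_ringHom_genericParam_eq_zero (v := .plane) F F' rfl
  have hodgeStar_ne_zero_iff (j k : Fin 4) :
      hodgeStar (paramLine F (genericParam F F')) j k ≠ 0 ↔ (basePairGraph (Q 1)✶).Adj j k :=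
    paramLine_genericParam_ne_zero_iff.trans (basePairGraph_dual_adj hE).symm
  rw [planeCoord_paramCoords,
    linePoint_ne_zero_iff isDecomposable_paramLine.hodgeStar.isAlternating φ
      ((map_hodgeStar φ _).trans (congrArg hodgeStar map_line)) map_plane,
    hodgeStar_ne_zero_iff, hodgeStar_ne_zero_iff, F'.isNonloop_iff, genericParam_ne_zero_iff rfl]
  rfl

theorem paramCoords_genericParam_ne_zero_iff (hQ : IsFlagMatroid Set.univ ![1, 2, 3] Q)
    (x : FlagIndex) : paramCoords F F' (genericParam F F') x ≠ 0 ↔ IsBaseIndex Q x := by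
  revert x
  refine flagIndex_cases (fun j => ?_) (fun j k h => ?_) (fun j => ?_)
  · rw [isBaseIndex_pointIndex (hQ.eRank_eq 0)]
    exact pointCoord_paramCoords_genericParam_ne_zero_iff
  · rw [isBaseIndex_lineIndex, ← lineCoord_of_lt (paramCoords _ _ _) h,
      lineCoord_paramCoords, paramLine_genericParam_ne_zero_iff]
  · rw [isBaseIndex_planeIndex hQ.eRank_dual_plane (hQ.ground_eq 2),
      ← planeCoord_paramCoords_genericParam_ne_zero_iff (F := F) (F' := F') (hQ.ground_eq 1),
      planeCoord_eq_smul, smul_ne_zero_iff_ne]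

end GenericParameters

section ParametersAsRatios

open Matroid

variable {Q : Fin 3 → Matroid (Fin 4)} {F : Frame (Q 0) (Q 1)} {F' : Frame (Q 2)✶ (Q 1)✶}
  {j k : Fin 4}

/-- A natural linear form in the Plücker coordinates which is, up to sign, the coordinate indexed by
some basis of `Q i`. -/
def IsBaseCoord (Q : Fin 3 → Matroid (Fin 4)) (i : Fin 3)
    (c : ∀ A [CommRing A], (FlagIndex → A) → A) : Prop :=
  ∃ l, IsBaseIndex Q ⟨i, l⟩ ∧ ∃ e : ℤˣ, ∀ (A : Type) [CommRing A] (π : FlagIndex → A),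
    c A π = e • π ⟨i, l⟩

theorem isBaseCoord_pointCoord (hQ : IsFlagMatroid Set.univ ![1, 2, 3] Q)
    (hj : (Q 0).IsNonloop j) : IsBaseCoord Q 0 fun _ _ π => pointCoord π j :=
  ⟨(pointIndex j).2, (isBaseIndex_pointIndex (hQ.eRank_eq 0)).mpr hj, 1,
    fun _ _ _ => (one_smul _ _).symm⟩

theorem isBaseCoord_lineCoord (h : (basePairGraph (Q 1)).Adj j k) :
    IsBaseCoord Q 1 fun _ _ π => lineCoord π j k := by
  obtain ⟨e, he⟩ := exists_lineCoord_eq_smul h.ne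
  exact ⟨(lineIndex j k h.ne).2, (isBaseIndex_lineIndex h.ne).mpr h, e, fun _ _ π => he π⟩

theorem isBaseCoord_planeCoord (hQ : IsFlagMatroid Set.univ ![1, 2, 3] Q)
    (hj : (Q 2)✶.IsNonloop j) : IsBaseCoord Q 2 fun _ _ π => planeCoord π j :=
  ⟨(planeIndex j).2, (isBaseIndex_planeIndex hQ.eRank_dual_plane (hQ.ground_eq 2)).mpr hj, _,
    fun _ _ π => planeCoord_eq_smul π j⟩

theorem exists_isBaseCoord_paramNum_paramDen (hQ : IsFlagMatroid Set.univ ![1, 2, 3] Q)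
    {v : FlagParam} (hv : IsFreeParam F F' v) :
    ∃ i, IsBaseCoord Q i (fun _ _ π => paramNum F F' π v) ∧
      IsBaseCoord Q i (fun _ _ π => paramDen F F' π v) := by
  cases v with
  | scale j =>
    refine ⟨1, ?_, isBaseCoord_lineCoord F.adj⟩
    by_cases hjr : (basePairGraph (Q 1)).Adj j F.snd
    · simpa only [paramNum, if_pos hjr] using isBaseCoord_lineCoord hjr
    · simpa only [paramNum, if_neg hjr] using isBaseCoord_lineCoord (hv.1.resolve_right hjr)
  | slope C =>
    have isGeneric := (Frame.classRep_spec hv).1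
    exact ⟨1, isBaseCoord_lineCoord isGeneric.1, isBaseCoord_lineCoord isGeneric.2⟩
  | point => exact ⟨0, isBaseCoord_pointCoord hQ hv, isBaseCoord_pointCoord hQ F.isNonloop_fst⟩
  | plane => exact ⟨2, isBaseCoord_planeCoord hQ hv, isBaseCoord_planeCoord hQ F'.isNonloop_fst⟩

end ParametersAsRatios

section FlagChart

open Matroid

variable {Q : Fin 3 → Matroid (Fin 4)} (hQ : IsFlagMatroid Set.univ ![1, 2, 3] Q)

include hQ

theorem HasInvertibleBases.mem_flagCone {p : FlagIndex → ℂ} (hp : HasInvertibleBases Q p)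
    (hp' : SatisfiesPluckerRelations p) : p ∈ flagCone Set.univ ![1, 2, 3] := by
  obtain ⟨F⟩ := hQ.nonempty_frame_point
  obtain ⟨F'⟩ := hQ.nonempty_frame_plane
  refine mem_flagCone_of_satisfiesPluckerRelations hp' ?_ ?_ ?_
  · exact Function.ne_iff.mpr
      ⟨F.fst, (hp.isUnit_pointCoord (hQ.eRank_eq 0) F.isNonloop_fst).ne_zero⟩
  · exact Function.ne_iff.mpr
      ⟨F.fst, Function.ne_iff.mpr ⟨F.snd, (hp.isUnit_lineCoord F.adj).ne_zero⟩⟩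
  · exact Function.ne_iff.mpr ⟨F'.fst,
      (hp.isUnit_planeCoord hQ.eRank_dual_plane (hQ.ground_eq 2) F'.isNonloop_fst).ne_zero⟩

theorem exists_mul_eq_smul {F : Frame (Q 0) (Q 1)} {F' : Frame (Q 2)✶ (Q 1)✶} {v : FlagParam}
    (hv : IsFreeParam F F' v) :
    ∃ i l m, ∃ z : ℂ, IsBaseIndex Q ⟨i, l⟩ ∧ IsBaseIndex Q ⟨i, m⟩ ∧
      ∀ (A : Type) [CommRing A] [Algebra ℂ A] (π : FlagIndex → A) (t : A),
        t * paramDen F F' π v = paramNum F F' π v → t * π ⟨i, m⟩ = z • π ⟨i, l⟩ := by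
  obtain ⟨i, ⟨l, hl, e, num_eq⟩, m, hm, d, den_eq⟩ := exists_isBaseCoord_paramNum_paramDen hQ hv
  refine ⟨i, l, m, ((d⁻¹ * e : ℤˣ) : ℤ), hl, hm, fun A _ _ π t h => ?_⟩
  replace h : t * d • π ⟨i, m⟩ = e • π ⟨i, l⟩ :=
    (congrArg (t * ·) (den_eq A π)).symm.trans (h.trans (num_eq A π))
  rw [mul_smul_comm, ← eq_inv_smul_iff, smul_smul] at h
  rw [h, Units.smul_def, Int.cast_smul_eq_zsmul]

theorem isUnit_paramDen {A : Type} [CommRing A] {π : FlagIndex → A} (hπ : HasInvertibleBases Q π)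
    {F : Frame (Q 0) (Q 1)} {F' : Frame (Q 2)✶ (Q 1)✶} {v : FlagParam}
    (hv : IsFreeParam F F' v) : IsUnit (paramDen F F' π v) := by
  obtain ⟨i, -, m, hm, d, den_eq⟩ := exists_isBaseCoord_paramNum_paramDen hQ hv
  exact (congrArg IsUnit (den_eq A π)).mpr ((isUnit_smul_iff d _).mpr (hπ.isUnit _ hm))

omit hQ in
theorem hasInvertibleBases_coordRatio
    {index : ∀ i, {l : Finset (Set.univ : Set (Fin 4)) // l.card = ![1, 2, 3] i}}
    (hindex : ∀ i, IsBaseIndex Q ⟨i, index i⟩) :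
    HasInvertibleBases Q fun x => coordRatio Q x.1 x.2 (index x.1) where
  isUnit x hx := isUnit_coordRatio hx (hindex x.1)
  eq_zero _ hx := coordRatio_of_not_isBaseIndex hx

theorem exists_stratumChart : ∃ τ : Type, Finite τ ∧
    Nonempty (StratumChart Set.univ ![1, 2, 3] Q τ) := by
  obtain ⟨F⟩ := hQ.nonempty_frame_point
  obtain ⟨F'⟩ := hQ.nonempty_frame_plane
  choose index isBaseIndex_index using hQ.exists_isBaseIndex
  let ρ (x : FlagIndex) : stratumRing Set.univ ![1, 2, 3] Q := coordRatio Q x.1 x.2 (index x.1)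
  have bases : HasInvertibleBases Q ρ := hasInvertibleBases_coordRatio isBaseIndex_index
  let param (v : {v // IsFreeParam F F' v}) := paramNum F F' ρ v * Ring.inverse (paramDen F F' ρ v)
  have param_mul (v) : param v * paramDen F F' ρ v = paramNum F F' ρ v :=
    Ring.inverse_mul_cancel_right _ _ (isUnit_paramDen hQ bases v.2)
  let coord := paramCoords F F' (genericParam F F')
  have coord_ne_zero_iff (x) : coord x ≠ 0 ↔ IsBaseIndex Q x :=
    paramCoords_genericParam_ne_zero_iff hQ x
  obtain ⟨d, isUnit_d, d_mul⟩ := exists_isUnit_paramCoords_eq hQ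
    (satisfiesPluckerRelations_coordRatio index) bases param_mul
  have aeval_coord : MvPolynomial.aeval (R := ℂ) param ∘ coord = fun x => d x.1 * ρ x :=
    (aeval_comp_paramCoords_genericParam param).trans d_mul
  refine ⟨_, inferInstance, ⟨{
    coord, coord_ne_zero_iff, index, isBaseIndex_index, param
    aeval_coord_mem_flagCone := fun t ht => ?_
    exists_X_eq_param_eq := fun v => ?_
    exists_isUnit_aeval_coord := fun i =>
      ⟨d i, isUnit_d i, fun l => congrFun aeval_coord ⟨i, l⟩⟩ }⟩⟩
  · have bases_t : HasInvertibleBases Q fun x => MvPolynomial.aeval t (coord x) :=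
      ⟨fun x hx => (ht x hx).isUnit, fun x hx => by
        rw [not_not.mp (mt (coord_ne_zero_iff x).mp hx), map_zero]⟩
    exact bases_t.mem_flagCone hQ ((congrArg SatisfiesPluckerRelations
      (aeval_comp_paramCoords_genericParam t)).mpr satisfiesPluckerRelations_paramCoords)
  · obtain ⟨i, l, m, z, hl, hm, mul_eq⟩ := exists_mul_eq_smul hQ v.2
    refine ⟨i, l, m, z, hl, hm, ?_, mul_eq _ ρ _ (param_mul v)⟩
    rw [← MvPolynomial.smul_eq_C_mul, ← genericParam_coe]
    exact mul_eq _ coord _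
      (mul_paramDen_paramCoords extendParam_scale_fst extendParam_scale_snd v.2)

end FlagChart

theorem mainTheorem5_general (Q : Fin 3 → Matroid (Fin 4))
    (hQ : IsFlagMatroid Set.univ ![1, 2, 3] Q) :
    AlgebraicGeometry.Smooth (flagStratumToSpec Set.univ ![1, 2, 3] Q) ∧
    IrreducibleSpace (flagStratum Set.univ ![1, 2, 3] Q) ∧
    IsOpenInTorus Set.univ ![1, 2, 3] Q := by
  obtain ⟨τ, _, ⟨chart⟩⟩ := exists_stratumChart hQ
  exact ⟨chart.smooth, chart.irreducibleSpace, chart.isOpenInTorus⟩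

theorem mainTheorem5 (Q : Fin 3 → Matroid (Fin 4))
    (hQ : IsFlagMatroid Set.univ ![1, 2, 3] Q) :
    AlgebraicGeometry.Smooth (flagStratumToSpec Set.univ ![1, 2, 3] Q) ∧
    IrreducibleSpace (flagStratum Set.univ ![1, 2, 3] Q) ∧
    (IsProductOfSmallerStrata Set.univ ![1, 2, 3] Q ∨
      IsOpenInTorus Set.univ ![1, 2, 3] Q) :=
  (mainTheorem5_general Q hQ).imp_right (And.imp_right Or.inr)
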